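/- Let $\mathcal T=(\mathcal V,\mathcal E)$ be a finite tree (a connected acyclic graph) with vertices $\mathcal V=\{1,\dots,J\}$, $J\ge 2$; let $\mathcal N_j$ be the set of neighbours of $j$, and let $\mathcal L$ be the set of leaves (vertices of degree one), enumerated as $\ell_1,\dots,\ell_m$. For each edge let $C^{(j_1,j_2)}\in\mathbb R_+^{n\times n}$ be a cost matrix, with $C^{(j_2,j_1)}=(C^{(j_1,j_2)})^T$; let $\epsilon>0$, $K^{(j_1,j_2)}=\exp(-C^{(j_1,j_2)}/\epsilon)$ (elementwise), and let $\mathbf K_{i_1,\dots,i_J}=\exp\bigl(-\tfrac1\epsilon\sum_{(j_1,j_2)\in\mathcal E}C^{(j_1,j_2)}_{i_{j_1},i_{j_2}}\bigr)$, where the sum contains each undirected edge once. For each leaf $j$ let $\mu_j\in\mathbb R^n$ be a vector with strictly positive entries, all $\mu_j$ having the same total mass. The dual of the entropy regularized multi-marginal optimal transport problem with given marginals $\mu_j$, $j\in\mathcal L$, is $$\max_{\lambda_j\in\mathbb R^n,\ j\in\mathcal L}\ -\epsilon\langle\mathbf K,\mathbf U\rangle+\sum_{j\in\mathcal L}\lambda_j^T\mu_j,\qquad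 \mathbf U=u_1\otimes\dots\otimes u_J,\quad u_j=\begin{cases}\exp(\lambda_j/\epsilon), & j\in\mathcal L,\\ \mathbf 1, & j\notin\mathcal L.\end{cases}$$ Consider the following algorithm, in which $\odot$ and $./$ are the elementwise product and division. Start from vectors $u_j=u_j^0$, $j\in\mathcal L$, with strictly positive entries, put $u_k=\mathbf 1$ for $k\notin\mathcal L$, and compute the vectors $\alpha_{(j,k)}$, for all ordered pairs of adjacent vertices, from the recursion $$\alpha_{(j,k)}=K^{(j,k)}\Bigl(u_k\odot\bigodot_{l\in\mathcal N_k\setminus\{j\}}\alpha_{(k,l)}\Bigr),\tag{$*$}$$ which starts in the leaves $k$, where the product is empty. Choose any leaf $j=\ell_p$ to begin with, and then repeat the following iteration: 1. $u_j\leftarrow\mu_j\,./\bigodot_{k\in\mathcal N_j}\alpha_{(j,k)}$. 2. Let $j'$ be the cyclically next leaf after $j$ in the enumeration. Along the path from $j$ to $j'$, edge after edge starting at $j$, recompute by $(*)$ the vector $\alpha_{(j_2,j_1)}$ for each edge traversed from $j_1$ to $j_2$, using the current values of $u$ and $\alpha$. 3. $j\leftarrow j'$. Let $u^k=(u_j^k)_{j\in\mathcal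 L}$ be the vectors after $k$ iterations. Then $u^k$ converges at least linearly (in the root sense) to an optimal solution of the dual problem, expressed in the variables $u_j=\exp(\lambda_j/\epsilon)$: there are an optimal solution $(\lambda_j^*)_{j\in\mathcal L}$ of the dual problem and constants $B\in\mathbb R$ and $q\in(0,1)$ such that $$\max_{j\in\mathcal L}\ \bigl\|u_j^k-\exp(\lambda_j^*/\epsilon)\bigr\|_\infty\le B\,q^k\qquad\text{for all }k\ge 0 .$$ -/

import Mathlib

noncomputable section

namespace TreeSinkhorn

variable {J n m : ℕ}

/-- The set of leaves of a graph on the vertices `0, …, J - 1`: the vertices of degree one. -/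
def leaves (T : SimpleGraph (Fin J)) [DecidableRel T.Adj] : Finset (Fin J) :=
  Finset.univ.filter fun j => T.degree j = 1

/-- The tree-structured cost tensor: `𝐂 (i₁, …, i_J)` is the sum of `C^(j₁,j₂) (i_{j₁}, i_{j₂})`
over the edges. The condition `j₁ < j₂` makes every undirected edge occur exactly once. -/
def costTensor (T : SimpleGraph (Fin J)) [DecidableRel T.Adj]
    (C : Fin J → Fin J → Matrix (Fin n) (Fin n) ℝ) (i : Fin J → Fin n) : ℝ :=
  ∑ j₁, ∑ j₂, if j₁ < j₂ ∧ T.Adj j₁ j₂ then C j₁ j₂ (i j₁) (i j₂) else 0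

/-- The tensor `𝐊 = exp (-𝐂 / ε)` (elementwise). -/
def gibbsTensor (T : SimpleGraph (Fin J)) [DecidableRel T.Adj]
    (C : Fin J → Fin J → Matrix (Fin n) (Fin n) ℝ) (ε : ℝ) (i : Fin J → Fin n) : ℝ :=
  Real.exp (-costTensor T C i / ε)

/-- The matrices `K^(j₁,j₂) = exp (-C^(j₁,j₂) / ε)` (elementwise). -/
def gibbsMatrix (C : Fin J → Fin J → Matrix (Fin n) (Fin n) ℝ) (ε : ℝ) (j₁ j₂ : Fin J) :
    Matrix (Fin n) (Fin n) ℝ :=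
  Matrix.of fun a b => Real.exp (-C j₁ j₂ a b / ε)

/-- The tensor product `u₁ ⊗ ⋯ ⊗ u_J`. -/
def outer (u : Fin J → Fin n → ℝ) (i : Fin J → Fin n) : ℝ :=
  ∏ j, u j (i j)

/-- The family `(u_j)_{j ∈ Γ}`, completed by `u_j = 𝟏` for `j ∉ Γ`. -/
def extendByOne (Γ : Finset (Fin J)) (u : Γ → Fin n → ℝ) (j : Fin J) : Fin n → ℝ :=
  if h : j ∈ Γ then u ⟨j, h⟩ else 1

/-- The change of variables `u_j = exp (lam_j / ε)` (elementwise), for `j ∈ Γ`. -/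
def scaling {Γ : Finset (Fin J)} (ε : ℝ) (lam : Γ → Fin n → ℝ) : Γ → Fin n → ℝ :=
  fun j a => Real.exp (lam j a / ε)

/-- The objective `-ε ⟨𝐊, 𝐔⟩ + ∑_{j ∈ Γ} lam_jᵀ μ_j` of the dual of the entropy regularized
multi-marginal optimal transport problem with the marginals `μ_j`, `j ∈ Γ`, given. -/
def dualObjective (T : SimpleGraph (Fin J)) [DecidableRel T.Adj]
    (C : Fin J → Fin J → Matrix (Fin n) (Fin n) ℝ) (ε : ℝ) (Γ : Finset (Fin J))
    (μ : Γ → Fin n → ℝ) (lam : Γ → Fin n → ℝ) : ℝ :=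
  -ε * (∑ i, gibbsTensor T C ε i * outer (extendByOne Γ (scaling ε lam)) i)
    + ∑ j : Γ, lam j ⬝ᵥ μ j

/-- An optimal solution of the dual problem, in which all `lam_j`, `j ∈ Γ`, range over `ℝⁿ`. -/
def IsDualOptimal (T : SimpleGraph (Fin J)) [DecidableRel T.Adj]
    (C : Fin J → Fin J → Matrix (Fin n) (Fin n) ℝ) (ε : ℝ) (Γ : Finset (Fin J))
    (μ : Γ → Fin n → ℝ) (lam : Γ → Fin n → ℝ) : Prop :=
  IsMaxOn (dualObjective T C ε Γ μ) Set.univ lam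

/-- The right-hand side of the recursion for the vectors `α_(j,k)`, for adjacent `j`, `k`:
`K^(j,k) (u_k ⊙ ⨀_{ℓ ∈ N_k \ {j}} α_(k,ℓ))`. If `k` is a leaf, the product is empty and this
is `K^(j,k) u_k`. -/
def message (T : SimpleGraph (Fin J)) [DecidableRel T.Adj]
    (C : Fin J → Fin J → Matrix (Fin n) (Fin n) ℝ) (ε : ℝ)
    (u : leaves T → Fin n → ℝ) (α : Fin J → Fin J → Fin n → ℝ) (j k : Fin J) : Fin n → ℝ :=
  (gibbsMatrix C ε j k).mulVec
    (extendByOne (leaves T) u k * ∏ l ∈ (T.neighborFinset k).erase j, α k l)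

/-- The recursion started in the leaves, with at most `d` levels. -/
def messageIter (T : SimpleGraph (Fin J)) [DecidableRel T.Adj]
    (C : Fin J → Fin J → Matrix (Fin n) (Fin n) ℝ) (ε : ℝ) (u : leaves T → Fin n → ℝ) :
    ℕ → Fin J → Fin J → Fin n → ℝ
  | 0 => fun _ _ => 1
  | d + 1 => message T C ε u (messageIter T C ε u d)

/-- The initial vectors `α_(j,k)`. In a tree with `J` vertices the recursion has fewer than `J`
levels, so that `J` levels compute its solution: see `initMessages_eq`. Only the values at
adjacent `j`, `k` matter. -/
def initMessages (T : SimpleGraph (Fin J)) [DecidableRel T.Adj]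
    (C : Fin J → Fin J → Matrix (Fin n) (Fin n) ℝ) (ε : ℝ) (u : leaves T → Fin n → ℝ) :
    Fin J → Fin J → Fin n → ℝ :=
  messageIter T C ε u J

theorem messageIter_stable (T : SimpleGraph (Fin J)) [DecidableRel T.Adj] (hT : T.IsTree)
    (C : Fin J → Fin J → Matrix (Fin n) (Fin n) ℝ) (ε : ℝ) (u : leaves T → Fin n → ℝ) (d : ℕ) :
    ∀ (a j k : Fin J) (p : T.Walk a j) (h : T.Adj j k), (p.concat h).IsPath →
      J ≤ d + (p.concat h).length →
      messageIter T C ε u d j k = messageIter T C ε u (d + 1) j k := by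
  induction d with
  | zero =>
    intro a j k p h hp hd
    have := hp.length_lt
    simp only [Fintype.card_fin] at this
    omega
  | succ d ih =>
    intro a j k p h hp hd
    change message T C ε u _ j k = message T C ε u _ j k
    unfold message
    congr 2
    refine Finset.prod_congr rfl fun l hl => ?_
    rw [Finset.mem_erase, SimpleGraph.mem_neighborFinset] at hl
    refine ih a k l (p.concat h) hl.2 ?_ ?_
    · refine hp.concat (fun hmem => hl.1 ?_) hl.2
      have := hT.2.eq_penultimate_of_adj_end hp hl.2 hmem
      simpa using this
    · simp only [SimpleGraph.Walk.length_concat] at hd ⊢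
      omega

/-- The initial vectors `α_(j,k)` solve the recursion. -/
theorem initMessages_eq (T : SimpleGraph (Fin J)) [DecidableRel T.Adj] (hT : T.IsTree)
    (C : Fin J → Fin J → Matrix (Fin n) (Fin n) ℝ) (ε : ℝ) (u : leaves T → Fin n → ℝ)
    {j k : Fin J} (h : T.Adj j k) :
    initMessages T C ε u j k = message T C ε u (initMessages T C ε u) j k :=
  messageIter_stable T hT C ε u J j j k SimpleGraph.Walk.nil h
    (SimpleGraph.Walk.IsPath.nil.concat (by simpa using h.ne') h) (by simp)

/-- The path between two vertices of a tree. -/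
def treePath {T : SimpleGraph (Fin J)} (hT : T.IsTree) (v w : Fin J) : T.Walk v w :=
  (hT.existsUnique_path v w).choose

/-- The update of the single vector `α_(j,k)` according to its recursion. -/
def updateMessage (T : SimpleGraph (Fin J)) [DecidableRel T.Adj]
    (C : Fin J → Fin J → Matrix (Fin n) (Fin n) ℝ) (ε : ℝ)
    (u : leaves T → Fin n → ℝ) (j k : Fin J) (α : Fin J → Fin J → Fin n → ℝ) :
    Fin J → Fin J → Fin n → ℝ :=
  fun a b => if a = j ∧ b = k then message T C ε u α j k else α a b

/-- The updates of the vectors `α` on the path from `v` to `w`: the edges are visited one after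
the other from `v` to `w`, and for an edge traversed from `k` to `j` the vector `α_(j,k)`, which
carries the information sent from `k` to `j`, is recomputed. -/
def updatePath {T : SimpleGraph (Fin J)} [DecidableRel T.Adj] (hT : T.IsTree)
    (C : Fin J → Fin J → Matrix (Fin n) (Fin n) ℝ) (ε : ℝ)
    (u : leaves T → Fin n → ℝ) (v w : Fin J) (α : Fin J → Fin J → Fin n → ℝ) :
    Fin J → Fin J → Fin n → ℝ :=
  (treePath hT v w).darts.foldl (fun β e => updateMessage T C ε u e.snd e.fst β) α

/-- The variables of the algorithm: the number of the current leaf in the enumeration of the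
leaves, the vectors `u_j` for the leaves `j`, and the stored vectors `α_(j,k)`. -/
structure State (T : SimpleGraph (Fin J)) [DecidableRel T.Adj] (n m : ℕ) where
  /-- number of the current leaf -/
  pos : Fin m
  /-- the vectors `u_j` -/
  u : leaves T → Fin n → ℝ
  /-- the vectors `α_(j,k)` -/
  α : Fin J → Fin J → Fin n → ℝ

/-- The state before the while-loop, for the initial guess `u₀` and the first leaf `p₀`. -/
def initState (T : SimpleGraph (Fin J)) [DecidableRel T.Adj]
    (C : Fin J → Fin J → Matrix (Fin n) (Fin n) ℝ) (ε : ℝ)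
    (u₀ : leaves T → Fin n → ℝ) (p₀ : Fin m) : State T n m where
  pos := p₀
  u := u₀
  α := initMessages T C ε u₀

/-- One iteration of the while-loop, where `σ` enumerates the leaves. With `j` the current leaf:
`u_j ← μ_j ./ ⨀_{k ∈ N_j} α_(j,k)`; then the vectors `α` on the path from `j` to the
(cyclically) next leaf are updated; then the next leaf becomes the current one. -/
def step {T : SimpleGraph (Fin J)} [DecidableRel T.Adj] (hT : T.IsTree)
    (C : Fin J → Fin J → Matrix (Fin n) (Fin n) ℝ) (ε : ℝ)
    (μ : leaves T → Fin n → ℝ) (σ : Fin m ≃ leaves T) (s : State T n m) : State T n m :=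
  let j := σ s.pos
  let next := finRotate m s.pos
  let u' := Function.update s.u j (μ j / ∏ k ∈ T.neighborFinset j, s.α j k)
  { pos := next
    u := u'
    α := updatePath hT C ε u' j (σ next) s.α }

/-- The vectors `(u_j^k)_j`, `j` a leaf, after `k` iterations of the while-loop. -/
def iterates {T : SimpleGraph (Fin J)} [DecidableRel T.Adj] (hT : T.IsTree)
    (C : Fin J → Fin J → Matrix (Fin n) (Fin n) ℝ) (ε : ℝ)
    (μ : leaves T → Fin n → ℝ) (σ : Fin m ≃ leaves T)
    (u₀ : leaves T → Fin n → ℝ) (p₀ : Fin m) (k : ℕ) : leaves T → Fin n → ℝ :=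
  ((step hT C ε μ σ)^[k] (initState T C ε u₀ p₀)).u

/-- At least linear (that is, R-linear) convergence of a sequence in a normed space. -/
def ConvergesAtLeastLinearly {E : Type*} [NormedAddCommGroup E] (x : ℕ → E) (y : E) : Prop :=
  ∃ B q : ℝ, 0 < q ∧ q < 1 ∧ ∀ k : ℕ, ‖x k - y‖ ≤ B * q ^ k

end TreeSinkhorn

end

set_option linter.unusedSectionVars false

namespace TreeSinkhorn

/-! ### Elementary inequalities for the exponential function -/

/-! In the variables `x = log u = λ / ε` the dual objective is `-ε` times a smooth convex energy,
whose gradient is the difference between the marginals of the scaled tensor and the `μ_j`. The proof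
identifies the algorithm with exact cyclic block minimization of this energy and shows that the
descent is linear.

Identification: summing out the vertices of the tree, children before parents, shows that the
product of the messages into `j` is the `j`-th marginal with the factor `u_j` removed
(`sum_gibbsTensor_mul_outer`). Recomputing messages along a path suffices: changing `u_j` leaves the
messages towards `j` unchanged, and moving the root across an edge reverses that edge only
(`state_messages_eq`). Hence `log_iterates_succ`.

Convergence: after a step the oscillation of the updated block is bounded in terms of `K` and `μ`
alone, and the total mass is the prescribed one, so all entries of the scaled tensor stay in a fixed
interval `[w, S]` with `w > 0`. There the squared step size is at most a constant times the energy
decrease, the squared violation of the marginals at most a constant times the decrease over a full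
cycle, and energy differences at most a constant times the squared violation
(`exists_energy_sub_le`). The last estimate survives the non-uniqueness of the dual solution because
it only uses the change of log-weights. Together these make the energy decrease geometrically, so
the steps are geometrically small and the iterates Cauchy. The limit has the right marginals and is
optimal by convexity; no optimum has to be known beforehand. -/

theorem abs_exp_sub_one_le_of_abs_le {t D : ℝ} (h : |t| ≤ D) :
    |Real.exp t - 1| ≤ Real.exp D * |t| := by
  have hD : 0 ≤ D := (abs_nonneg t).trans h
  have h1 : 1 ≤ Real.exp D := Real.one_le_exp hD
  rcases le_total 0 t with ht | ht
  · rw [abs_of_nonneg ht] at h ⊢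
    rw [abs_of_nonneg (by linarith [Real.add_one_le_exp t])]
    have h2 : Real.exp t * (1 - t) ≤ 1 := by
      calc Real.exp t * (1 - t) ≤ Real.exp t * Real.exp (-t) := by
            gcongr; linarith [Real.add_one_le_exp (-t)]
        _ = 1 := by rw [← Real.exp_add]; simp
    have h3 : Real.exp t ≤ Real.exp D := Real.exp_le_exp.2 h
    nlinarith
  · have h2 : Real.exp t ≤ 1 := Real.exp_le_one_iff.2 ht
    rw [abs_of_nonpos ht, abs_of_nonpos (by linarith)]
    nlinarith [Real.add_one_le_exp t]

/-- The difference of `exp t - 1 - t` and `(exp (t/2) - 1)^2` is `2 (exp (t/2) - 1 - t/2) ≥ 0`, and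
`|exp (t/2) - 1|` is at least `exp (-D/2) |t| / 2`. This is the strong convexity behind all
quadratic lower bounds. -/
theorem exp_sub_one_sub_self_ge {t D : ℝ} (h : |t| ≤ D) :
    Real.exp (-D) / 4 * t ^ 2 ≤ Real.exp t - 1 - t := by
  have key : (Real.exp (t / 2) - 1) ^ 2 ≤ Real.exp t - 1 - t := by
    have : Real.exp t = Real.exp (t / 2) ^ 2 := by
      rw [← Real.exp_nat_mul]; congr 1; push_cast; ring
    nlinarith [Real.add_one_le_exp (t / 2)]
  refine le_trans ?_ key
  have hD : 0 ≤ D := (abs_nonneg t).trans h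
  have hD1 : Real.exp (-D) ≤ 1 := Real.exp_le_one_iff.2 (by linarith)
  rcases le_total 0 t with ht | ht
  · have := Real.add_one_le_exp (t / 2)
    have h3 : (t / 2) ^ 2 ≤ (Real.exp (t / 2) - 1) ^ 2 :=
      pow_le_pow_left₀ (by linarith) (by linarith) 2
    nlinarith [sq_nonneg t]
  · have h1 : Real.exp (t / 2) * (-(t / 2)) ≤ 1 - Real.exp (t / 2) := by
      have : Real.exp (t / 2) * (1 - t / 2) ≤ Real.exp (t / 2) * Real.exp (-(t / 2)) := by
        gcongr; linarith [Real.add_one_le_exp (-(t / 2))]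
      rw [← Real.exp_add, add_neg_cancel, Real.exp_zero] at this
      linarith
    have h0 : 0 ≤ Real.exp (t / 2) * (-(t / 2)) := by
      have := Real.exp_pos (t / 2); nlinarith
    have h2 := pow_le_pow_left₀ h0 h1 2
    have h3 : Real.exp (-D) ≤ Real.exp (t / 2) ^ 2 := by
      rw [← Real.exp_nat_mul]
      apply Real.exp_le_exp.2
      rw [abs_of_nonpos ht] at h
      push_cast; linarith
    nlinarith [sq_nonneg t, mul_le_mul_of_nonneg_right h3 (sq_nonneg t)]

theorem abs_exp_sub_exp_le (a b D : ℝ) (h : |a - b| ≤ D) :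
    |Real.exp a - Real.exp b| ≤ Real.exp b * Real.exp D * |a - b| := by
  have h1 := abs_exp_sub_one_le_of_abs_le h
  have : Real.exp a - Real.exp b = Real.exp b * (Real.exp (a - b) - 1) := by
    rw [mul_sub, ← Real.exp_add]; simp
  rw [this, abs_mul, abs_of_pos (Real.exp_pos b), mul_assoc]
  gcongr

/-! ### Sequences with a multi-step contraction -/

/-- An antitone sequence whose remaining decrease is controlled by the decrease over the next `N`
steps decreases geometrically. -/
theorem geometric_decrease {F : ℕ → ℝ} (hF : Antitone F) {N : ℕ} (hN : N ≠ 0) {C : ℝ}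
    (h : ∀ k l, F k - F l ≤ C * (F k - F (k + N))) :
    ∃ A q : ℝ, 0 ≤ A ∧ 0 < q ∧ q < 1 ∧ ∀ k l, F k - F l ≤ A * q ^ k := by
  have hb : BddBelow (Set.range F) := by
    refine ⟨F 0 - C * (F 0 - F (0 + N)), ?_⟩
    rintro _ ⟨l, rfl⟩
    linarith [h 0 l]
  set L := ⨅ k, F k with hL
  have hLe : ∀ k, L ≤ F k := fun k => ciInf_le hb k
  -- The lower bound 2 keeps the contraction factor `θ = 1 - 1 / C'` positive, so that its `N`-th
  -- root is a valid rate.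
  set C' := max C 2 with hC'
  have hC2 : 2 ≤ C' := le_max_right _ _
  have h' : ∀ k, F k - L ≤ C' * (F k - F (k + N)) := by
    intro k
    have h1 : F k - C' * (F k - F (k + N)) ≤ L := by
      refine le_ciInf fun l => ?_
      have h2 : 0 ≤ F k - F (k + N) := sub_nonneg.2 (hF (Nat.le_add_right k N))
      have h3 : C * (F k - F (k + N)) ≤ C' * (F k - F (k + N)) :=
        mul_le_mul_of_nonneg_right (le_max_left _ _) h2
      linarith [h k l]
    linarith
  set θ := 1 - 1 / C' with hθ
  have hC0 : 0 < C' := by linarith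
  have hinv : 1 / C' ≤ 1 / 2 := one_div_le_one_div_of_le (by norm_num) hC2
  have hinv0 : 0 < 1 / C' := by positivity
  have hθ0 : 0 < θ := by linarith
  have hθ1 : θ < 1 := by linarith
  have hcontr : ∀ k, F (k + N) - L ≤ θ * (F k - L) := by
    intro k
    have h1 : (F k - L) / C' ≤ F k - F (k + N) := by
      rw [div_le_iff₀ hC0, mul_comm]; exact h' k
    have h2 : θ * (F k - L) = (F k - L) - (F k - L) / C' := by rw [hθ]; ring
    linarith
  set q := θ ^ ((1 : ℝ) / N) with hq
  have hNpos : (0 : ℝ) < N := by exact_mod_cast Nat.pos_of_ne_zero hN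
  have hq0 : 0 < q := Real.rpow_pos_of_pos hθ0 _
  have hq1 : q < 1 := Real.rpow_lt_one hθ0.le hθ1 (by positivity)
  have hqN : q ^ N = θ := by
    rw [hq, ← Real.rpow_natCast, ← Real.rpow_mul hθ0.le]
    rw [one_div, inv_mul_cancel₀ hNpos.ne', Real.rpow_one]
  have hg0 : 0 ≤ F 0 - L := sub_nonneg.2 (hLe 0)
  -- Dividing by `q ^ N` makes the bound hold for the first `N` indices by monotonicity alone.
  refine ⟨(F 0 - L) / q ^ N, q, by positivity, hq0, hq1, fun k l => ?_⟩
  suffices H : F k - L ≤ (F 0 - L) / q ^ N * q ^ k by linarith [hLe l]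
  clear l
  induction k using Nat.strong_induction_on with
  | _ k ih =>
    rcases lt_or_ge k N with hk | hk
    · have h1 : q ^ N ≤ q ^ k := pow_le_pow_of_le_one hq0.le hq1.le hk.le
      have h2 : F k ≤ F 0 := hF (Nat.zero_le k)
      calc F k - L ≤ F 0 - L := by linarith
        _ = (F 0 - L) / q ^ N * q ^ N := by field_simp
        _ ≤ _ := by gcongr
    · obtain ⟨r, rfl⟩ := Nat.exists_eq_add_of_le' hk
      have h1 := ih r (by omega)
      calc F (r + N) - L ≤ θ * (F r - L) := hcontr r
        _ ≤ θ * ((F 0 - L) / q ^ N * q ^ r) := by gcongr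
        _ = _ := by rw [pow_add, hqN]; ring

/-! ### Sums over configurations -/

/-- Summing over a coordinate twice. -/
theorem sum_sum_update {V α M : Type*} [Fintype V] [DecidableEq V] [Fintype α] [AddCommMonoid M]
    (F : (V → α) → M) (c : V) :
    ∑ i, ∑ b, F (Function.update i c b) = Fintype.card α • ∑ i, F i := by
  have h : ∑ p : (V → α) × α, F (Function.update p.1 c p.2) = ∑ p : (V → α) × α, F p.1 := by
    -- Exchanging the coordinate `c` of the configuration with the extra variable is an involution.
    refine Fintype.sum_bijective (fun p => (Function.update p.1 c p.2, p.1 c)) ?_ _ _ fun p => rfl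
    refine Function.Involutive.bijective fun p => ?_
    ext <;> simp
  rw [Fintype.sum_prod_type, Fintype.sum_prod_type] at h
  simp only [Finset.sum_const, Finset.card_univ] at h
  rw [h, Finset.smul_sum]

/-! ### The energy and its exact minimization in one block -/

section Analysis

variable {V α : Type*} [Fintype V] [DecidableEq V] [Fintype α] [DecidableEq α] {Γ : Finset V}

/-- The entries `K_i exp (∑_j x_j (i_j))` of the scaled tensor. -/
noncomputable def weight (K : (V → α) → ℝ) (x : Γ → α → ℝ) (i : V → α) : ℝ :=
  K i * Real.exp (∑ j : Γ, x j (i j))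

/-- The `j`-th marginal of the scaled tensor. -/
noncomputable def marginal (K : (V → α) → ℝ) (x : Γ → α → ℝ) (j : Γ) (a : α) : ℝ :=
  ∑ i, if i j = a then weight K x i else 0

/-- The negative of the dual objective for `ε = 1`. -/
noncomputable def energy (K : (V → α) → ℝ) (μ : Γ → α → ℝ) (x : Γ → α → ℝ) : ℝ :=
  ∑ i, weight K x i - ∑ j, ∑ a, x j a * μ j a

/-- Exact minimization of the energy in the block `j`. -/
noncomputable def logStep (K : (V → α) → ℝ) (μ : Γ → α → ℝ) (j : Γ) (x : Γ → α → ℝ) : Γ → α → ℝ :=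
  Function.update x j fun a => x j a + (Real.log (μ j a) - Real.log (marginal K x j a))

theorem sum_marginal_mul (K : (V → α) → ℝ) (x : Γ → α → ℝ) (j : Γ) (g : α → ℝ) :
    ∑ a, marginal K x j a * g a = ∑ i, weight K x i * g (i j) := by
  simp only [marginal, Finset.sum_mul]
  rw [Finset.sum_comm]
  refine Finset.sum_congr rfl fun i _ => ?_
  simp [ite_mul]

theorem sum_marginal (K : (V → α) → ℝ) (x : Γ → α → ℝ) (j : Γ) :
    ∑ a, marginal K x j a = ∑ i, weight K x i := by
  simpa using sum_marginal_mul K x j fun _ => 1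

theorem weight_add (K : (V → α) → ℝ) (x h : Γ → α → ℝ) (i : V → α) :
    weight K (x + h) i = weight K x i * Real.exp (∑ j : Γ, h j (i j)) := by
  simp [weight, Finset.sum_add_distrib, Real.exp_add, mul_assoc]

/-- The Taylor expansion of the energy, with its exact remainder. -/
theorem energy_add_sub (K : (V → α) → ℝ) (μ x h : Γ → α → ℝ) :
    energy K μ (x + h) - energy K μ x =
      ∑ j, ∑ a, (marginal K x j a - μ j a) * h j a +
        ∑ i, weight K x i *
          (Real.exp (∑ j : Γ, h j (i j)) - 1 - ∑ j : Γ, h j (i j)) := by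
  have h1 : ∑ j, ∑ a, marginal K x j a * h j a = ∑ i, weight K x i * ∑ j : Γ, h j (i j) := by
    simp only [sum_marginal_mul, Finset.mul_sum]
    rw [Finset.sum_comm]
  simp only [energy, weight_add, sub_mul, mul_sub, Finset.sum_sub_distrib, Pi.add_apply, add_mul,
    Finset.sum_add_distrib, h1, mul_one, mul_comm (h _ _) (μ _ _)]
  ring

variable {K : (V → α) → ℝ} {μ : Γ → α → ℝ}

theorem weight_pos (hK : ∀ i, 0 < K i) (x : Γ → α → ℝ) (i : V → α) : 0 < weight K x i :=
  mul_pos (hK i) (Real.exp_pos _)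

theorem weight_le_marginal (hK : ∀ i, 0 < K i) (x : Γ → α → ℝ) (j : Γ) (i : V → α) :
    weight K x i ≤ marginal K x j (i j) := by
  have := Finset.single_le_sum (f := fun i' => if i' j = i j then weight K x i' else 0)
    (fun i' _ => by split_ifs <;> [exact (weight_pos hK x i').le; exact le_rfl])
    (Finset.mem_univ i)
  simpa [marginal] using this

theorem marginal_pos [Nonempty α] (hK : ∀ i, 0 < K i) (x : Γ → α → ℝ) (j : Γ) (a : α) :
    0 < marginal K x j a :=
  (weight_pos hK x _).trans_le (by simpa using weight_le_marginal hK x j fun _ => a)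

theorem marginal_le_sum_weight (hK : ∀ i, 0 < K i) (x : Γ → α → ℝ) (j : Γ) (a : α) :
    marginal K x j a ≤ ∑ i, weight K x i :=
  Finset.sum_le_sum fun i _ => by split_ifs <;> [exact le_rfl; exact (weight_pos hK x i).le]

/-- Points where all marginals are the given ones minimize the energy. -/
theorem energy_le_of_marginal_eq (hK : ∀ i, 0 < K i) {x : Γ → α → ℝ}
    (hx : ∀ j a, marginal K x j a = μ j a) (y : Γ → α → ℝ) : energy K μ x ≤ energy K μ y := by
  have h := energy_add_sub K μ x (y - x)
  simp only [hx, sub_self, zero_mul, Finset.sum_const_zero, zero_add, add_sub_cancel] at h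
  have h2 : 0 ≤ energy K μ y - energy K μ x := by
    rw [h]
    refine Finset.sum_nonneg fun i _ => mul_nonneg (weight_pos hK x i).le ?_
    linarith [Real.add_one_le_exp (∑ j : Γ, (y - x) j (i j))]
  linarith

/-- The logarithmic mismatch of the `j`-th marginal. -/
noncomputable def logGap (K : (V → α) → ℝ) (μ : Γ → α → ℝ) (j : Γ) (x : Γ → α → ℝ) (a : α) : ℝ :=
  Real.log (marginal K x j a) - Real.log (μ j a)

theorem logStep_eq_add (j : Γ) (x : Γ → α → ℝ) :
    logStep K μ j x = x + Pi.single j (fun a => -logGap K μ j x a) := by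
  ext l a
  rcases eq_or_ne l j with rfl | hl
  · simp [logStep, logGap]
  · simp [logStep, hl]

theorem sum_single_apply (j : Γ) (g : α → ℝ) (i : V → α) :
    ∑ l : Γ, (Pi.single j g : Γ → α → ℝ) l (i l) = g (i j) := by
  rw [Finset.sum_eq_single j]
  · simp
  · intro l _ hl; simp [hl]
  · simp

theorem weight_logStep (j : Γ) (x : Γ → α → ℝ) (i : V → α) :
    weight K (logStep K μ j x) i = weight K x i * Real.exp (-logGap K μ j x (i j)) := by
  rw [logStep_eq_add, weight_add, sum_single_apply]

theorem exp_logGap [Nonempty α] (hK : ∀ i, 0 < K i) (hμ : ∀ j a, 0 < μ j a)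
    (j : Γ) (x : Γ → α → ℝ) (a : α) :
    μ j a * Real.exp (logGap K μ j x a) = marginal K x j a := by
  rw [logGap, Real.exp_sub, Real.exp_log (marginal_pos hK x j a), Real.exp_log (hμ j a)]
  field_simp [(hμ j a).ne']

theorem marginal_logStep [Nonempty α] (hK : ∀ i, 0 < K i) (hμ : ∀ j a, 0 < μ j a)
    (j : Γ) (x : Γ → α → ℝ) (a : α) : marginal K (logStep K μ j x) j a = μ j a := by
  have h1 : marginal K (logStep K μ j x) j a =
      marginal K x j a * Real.exp (-logGap K μ j x a) := by
    simp only [marginal, Finset.sum_mul]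
    refine Finset.sum_congr rfl fun i _ => ?_
    split_ifs with h
    · rw [weight_logStep, h]
    · simp
  rw [h1, ← exp_logGap hK hμ, mul_assoc, ← Real.exp_add]
  simp

/-- Any single marginal carries the total mass, so one step fixes this mass at that of `μ j`. -/
theorem sum_weight_logStep [Nonempty α] (hK : ∀ i, 0 < K i) (hμ : ∀ j a, 0 < μ j a)
    (j : Γ) (x : Γ → α → ℝ) : ∑ i, weight K (logStep K μ j x) i = ∑ a, μ j a := by
  rw [← sum_marginal K _ j]
  exact Finset.sum_congr rfl fun a _ => marginal_logStep hK hμ j x a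

/-- The decrease of the energy in one step. -/
theorem energy_sub_energy_logStep [Nonempty α] (hK : ∀ i, 0 < K i) (hμ : ∀ j a, 0 < μ j a)
    (j : Γ) (x : Γ → α → ℝ) :
    energy K μ x - energy K μ (logStep K μ j x) =
      ∑ a, μ j a * (Real.exp (logGap K μ j x a) - 1 - logGap K μ j x a) := by
  have h1 : ∑ l, ∑ a, logStep K μ j x l a * μ l a =
      ∑ l, ∑ a, x l a * μ l a - ∑ a, μ j a * logGap K μ j x a := by
    rw [logStep_eq_add]
    simp only [Pi.add_apply, add_mul, Finset.sum_add_distrib]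
    rw [Finset.sum_eq_single (f := fun l => ∑ a, (Pi.single j _ : Γ → α → ℝ) l a * μ l a) j]
    · simp only [Pi.single_eq_same, neg_mul, Finset.sum_neg_distrib, mul_comm (μ j _)]
      ring
    · intro l _ hl; simp [hl]
    · simp
  simp only [energy, h1, sum_weight_logStep hK hμ, mul_sub, Finset.sum_sub_distrib,
    exp_logGap hK hμ, sum_marginal, mul_one]
  ring

theorem energy_logStep_le [Nonempty α] (hK : ∀ i, 0 < K i) (hμ : ∀ j a, 0 < μ j a)
    (j : Γ) (x : Γ → α → ℝ) : energy K μ (logStep K μ j x) ≤ energy K μ x := by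
  have h := energy_sub_energy_logStep hK hμ j x
  have : 0 ≤ energy K μ x - energy K μ (logStep K μ j x) := by
    rw [h]
    refine Finset.sum_nonneg fun a _ => mul_nonneg (hμ j a).le ?_
    linarith [Real.add_one_le_exp (logGap K μ j x a)]
  linarith

/-! ### A priori bounds -/

/-- Overwriting the coordinate `j` by `a` hits each configuration with `i j = a` exactly `card α`
times. In this form the marginals at two points `a`, `b` can be compared term by term. -/
theorem card_mul_marginal (x : Γ → α → ℝ) (j : Γ) (a : α) :
    Fintype.card α * marginal K x j a = ∑ i, weight K x (Function.update i j a) := by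
  have h := sum_sum_update (fun i : V → α => if i j = a then weight K x i else 0) (j : V)
  simp only [Function.update_self, nsmul_eq_mul] at h
  rw [marginal, ← h]
  simp

theorem sum_update (x : Γ → α → ℝ) (j : Γ) (i : V → α) (a : α) :
    ∑ l : Γ, x l (Function.update i (j : V) a l) =
      x j a + ∑ l ∈ Finset.univ.erase j, x l (i l) := by
  rw [← Finset.add_sum_erase _ _ (Finset.mem_univ j), Function.update_self]
  congr 1
  refine Finset.sum_congr rfl fun l hl => ?_
  rw [Function.update_of_ne]
  exact fun h => Finset.ne_of_mem_erase hl (Subtype.ext h)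

/-- The quotient of `marginal K x j a` by `exp (x j a)` does not involve the block `j`; replacing
`a` by `b` in it only changes the entries of `K`, hence costs at most a factor `κ`. -/
theorem marginal_mul_exp_le [Nonempty α] {κ : ℝ}
    (hκ : ∀ i i', K i ≤ κ * K i') (x : Γ → α → ℝ) (j : Γ) (a b : α) :
    marginal K x j a * Real.exp (x j b) ≤ κ * (marginal K x j b * Real.exp (x j a)) := by
  have hc : (0 : ℝ) < Fintype.card α := by exact_mod_cast Fintype.card_pos
  refine le_of_mul_le_mul_left ?_ hc
  calc Fintype.card α * (marginal K x j a * Real.exp (x j b))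
      = ∑ i, weight K x (Function.update i j a) * Real.exp (x j b) := by
        rw [← mul_assoc, card_mul_marginal, Finset.sum_mul]
    _ ≤ ∑ i, κ * (weight K x (Function.update i j b) * Real.exp (x j a)) := by
        refine Finset.sum_le_sum fun i _ => ?_
        simp only [weight, sum_update, Real.exp_add]
        have := hκ (Function.update i j a) (Function.update i j b)
        calc _ = K (Function.update i j a) * (Real.exp (x j a) * Real.exp (x j b) *
              Real.exp (∑ l ∈ Finset.univ.erase j, x l (i l))) := by ring
          _ ≤ κ * K (Function.update i j b) * (Real.exp (x j a) * Real.exp (x j b) *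
              Real.exp (∑ l ∈ Finset.univ.erase j, x l (i l))) := by gcongr
          _ = _ := by ring
    _ = κ * (∑ i, weight K x (Function.update i j b)) * Real.exp (x j a) := by
        rw [← Finset.mul_sum, ← Finset.sum_mul, mul_assoc]
    _ = _ := by rw [← card_mul_marginal]; ring

/-- After a step in the block `j` the oscillation of this block is bounded. -/
theorem logStep_sub_le [Nonempty α] (hK : ∀ i, 0 < K i) {κ : ℝ} (hκ0 : 0 < κ)
    (hκ : ∀ i i', K i ≤ κ * K i') (x : Γ → α → ℝ) (j : Γ) (a b : α) :
    logStep K μ j x j a - logStep K μ j x j b ≤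
      Real.log (μ j a) - Real.log (μ j b) + Real.log κ := by
  have h := Real.log_le_log (mul_pos (marginal_pos hK x j b) (Real.exp_pos _))
    (marginal_mul_exp_le hκ x j b a)
  rw [Real.log_mul hκ0.ne' (mul_pos (marginal_pos hK x j a) (Real.exp_pos _)).ne',
    Real.log_mul (marginal_pos hK x j a).ne' (Real.exp_pos _).ne',
    Real.log_mul (marginal_pos hK x j b).ne' (Real.exp_pos _).ne', Real.log_exp, Real.log_exp] at h
  simp only [logStep, Function.update_self]
  linarith

theorem exists_ratio_bound [Nonempty α] (hK : ∀ i, 0 < K i) :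
    ∃ κ : ℝ, 0 < κ ∧ ∀ i i', K i ≤ κ * K i' := by
  obtain ⟨i₁, h₁⟩ := Finite.exists_max K
  obtain ⟨i₀, h₀⟩ := Finite.exists_min K
  refine ⟨K i₁ / K i₀, div_pos (hK _) (hK _), fun i i' => ?_⟩
  calc K i ≤ K i₁ := h₁ i
    _ = K i₁ / K i₀ * K i₀ := by field_simp [(hK i₀).ne']
    _ ≤ _ := mul_le_mul_of_nonneg_left (h₀ i') (div_pos (hK _) (hK _)).le

/-- The oscillation of the blocks stays bounded along the block coordinate descent. -/
theorem exists_oscillation_bound [Nonempty α] (hK : ∀ i, 0 < K i)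
    {x : ℕ → Γ → α → ℝ} {s : ℕ → Γ} (hx : ∀ k, x (k + 1) = logStep K μ (s k) (x k)) :
    ∃ R : ℝ, ∀ k j a b, x k j a - x k j b ≤ R := by
  obtain ⟨κ, hκ0, hκ⟩ := exists_ratio_bound hK
  obtain ⟨R₀, hR₀⟩ := (Set.finite_range fun p : Γ × α × α => x 0 p.1 p.2.1 - x 0 p.1 p.2.2).bddAbove
  obtain ⟨R₁, hR₁⟩ := (Set.finite_range fun p : Γ × α × α =>
    Real.log (μ p.1 p.2.1) - Real.log (μ p.1 p.2.2) + Real.log κ).bddAbove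
  refine ⟨max R₀ R₁, fun k => ?_⟩
  induction k with
  | zero => exact fun j a b => (hR₀ ⟨(j, a, b), rfl⟩).trans (le_max_left _ _)
  | succ k ih =>
    intro j a b
    rw [hx]
    rcases eq_or_ne j (s k) with rfl | hj
    · exact (logStep_sub_le hK hκ0 hκ _ _ a b).trans
        ((hR₁ ⟨(s k, a, b), rfl⟩).trans (le_max_right _ _))
    · simpa [logStep, hj] using ih j a b

/-- The entries of the scaled tensor stay bounded away from zero. -/
theorem exists_weight_lower_bound [Nonempty α] (hK : ∀ i, 0 < K i) (hμ : ∀ j a, 0 < μ j a)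
    {S : ℝ} (hS : 0 < S) (hmass : ∀ j, ∑ a, μ j a = S)
    {x : ℕ → Γ → α → ℝ} {s : ℕ → Γ} (hx : ∀ k, x (k + 1) = logStep K μ (s k) (x k)) :
    ∃ w : ℝ, 0 < w ∧ ∀ k i, w ≤ weight K (x (k + 1)) i := by
  obtain ⟨κ, hκ0, hκ⟩ := exists_ratio_bound hK
  obtain ⟨R, hR⟩ := exists_oscillation_bound hK hx
  -- Two entries at the same iterate differ by the ratio of the entries of `K` and one oscillation
  -- for each block.
  set c := κ * Real.exp (Fintype.card Γ * R) with hc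
  have hc0 : 0 < c := mul_pos hκ0 (Real.exp_pos _)
  have hle : ∀ k i i', weight K (x k) i' ≤ c * weight K (x k) i := by
    intro k i i'
    have h1 : ∑ j : Γ, x k j (i' j) ≤ Fintype.card Γ * R + ∑ j : Γ, x k j (i j) := by
      have : ∑ j : Γ, x k j (i' j) - ∑ j : Γ, x k j (i j) ≤ ∑ _j : Γ, R := by
        rw [← Finset.sum_sub_distrib]
        exact Finset.sum_le_sum fun j _ => hR k j _ _
      rw [Finset.sum_const, Finset.card_univ, nsmul_eq_mul] at this
      linarith
    calc weight K (x k) i' ≤ κ * K i * Real.exp (Fintype.card Γ * R + ∑ j : Γ, x k j (i j)) :=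
          mul_le_mul (hκ _ _) (Real.exp_le_exp.2 h1) (Real.exp_pos _).le
            (mul_pos hκ0 (hK _)).le
      _ = _ := by rw [Real.exp_add, weight]; ring
  have hN : (0 : ℝ) < Fintype.card (V → α) := by exact_mod_cast Fintype.card_pos
  refine ⟨S / (Fintype.card (V → α) * c), by positivity, fun k i => ?_⟩
  rw [div_le_iff₀ (by positivity)]
  -- The total mass is `S` only after a step, hence the index `k + 1`.
  calc S = ∑ i', weight K (x (k + 1)) i' := by
        rw [hx, sum_weight_logStep hK hμ, hmass]
    _ ≤ ∑ _i' : V → α, c * weight K (x (k + 1)) i := Finset.sum_le_sum fun i' _ => hle _ i i'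
    _ = _ := by rw [Finset.sum_const, Finset.card_univ, nsmul_eq_mul]; ring

end Analysis

/-! ### Energy estimates and linear convergence of block descent -/

section Convergence

variable {V α : Type*} [Fintype V] [DecidableEq V] [Fintype α] [DecidableEq α] {Γ : Finset V}
  {K : (V → α) → ℝ} {μ : Γ → α → ℝ}

/-- The total violation of the marginal constraints. -/
noncomputable def violation (K : (V → α) → ℝ) (μ x : Γ → α → ℝ) : ℝ :=
  ∑ j, ∑ a, |marginal K x j a - μ j a|

/-- The size of the step in the block `j`. -/
noncomputable def stepSize (K : (V → α) → ℝ) (μ : Γ → α → ℝ) (j : Γ) (x : Γ → α → ℝ) : ℝ :=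
  ∑ a, |logGap K μ j x a|

theorem stepSize_nonneg (j : Γ) (x : Γ → α → ℝ) : 0 ≤ stepSize K μ j x :=
  Finset.sum_nonneg fun _ _ => abs_nonneg _

theorem violation_nonneg (x : Γ → α → ℝ) : 0 ≤ violation K μ x :=
  Finset.sum_nonneg fun _ _ => Finset.sum_nonneg fun _ _ => abs_nonneg _

theorem abs_logGap_le_stepSize (j : Γ) (x : Γ → α → ℝ) (a : α) :
    |logGap K μ j x a| ≤ stepSize K μ j x :=
  Finset.single_le_sum (f := fun a => |logGap K μ j x a|) (fun _ _ => abs_nonneg _)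
    (Finset.mem_univ a)

theorem norm_logStep_sub_le (j : Γ) (x : Γ → α → ℝ) :
    ‖logStep K μ j x - x‖ ≤ stepSize K μ j x := by
  rw [pi_norm_le_iff_of_nonneg (stepSize_nonneg j x)]
  intro l
  rw [pi_norm_le_iff_of_nonneg (stepSize_nonneg j x)]
  intro a
  rw [logStep_eq_add, add_sub_cancel_left]
  rcases eq_or_ne l j with rfl | hl
  · simpa using abs_logGap_le_stepSize l x a
  · simpa [hl] using stepSize_nonneg j x

/-- Points of total mass `S` at which the scaled tensor is bounded below by `w`. -/
def Controlled (K : (V → α) → ℝ) (w S : ℝ) (x : Γ → α → ℝ) : Prop :=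
  (∀ i, w ≤ weight K x i) ∧ ∑ i, weight K x i = S

theorem Controlled.weight_le {w S : ℝ} {x : Γ → α → ℝ} (hK : ∀ i, 0 < K i)
    (hx : Controlled K w S x) (i : V → α) : weight K x i ≤ S := by
  rw [← hx.2]
  exact Finset.single_le_sum (fun i _ => (weight_pos hK x i).le) (Finset.mem_univ i)

theorem exists_logGap_bound [Nonempty α] (hK : ∀ i, 0 < K i) {w : ℝ} (hw : 0 < w) (S : ℝ) :
    ∃ D : ℝ, 0 ≤ D ∧ ∀ x : Γ → α → ℝ, Controlled K w S x → ∀ j a, |logGap K μ j x a| ≤ D := by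
  obtain ⟨L, hL⟩ := (Set.finite_range fun p : Γ × α => |Real.log (μ p.1 p.2)|).bddAbove
  refine ⟨|Real.log w| + |Real.log S| + |L|, by positivity, fun x hx j a => ?_⟩
  have h1 : w ≤ marginal K x j a :=
    (hx.1 fun _ => a).trans (by simpa using weight_le_marginal hK x j fun _ => a)
  have h2 : marginal K x j a ≤ S := hx.2 ▸ marginal_le_sum_weight hK x j a
  have h3 := Real.log_le_log hw h1
  have h4 := Real.log_le_log (hw.trans_le h1) h2
  have h5 : |Real.log (μ j a)| ≤ L := hL ⟨(j, a), rfl⟩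
  rw [logGap, abs_le]
  rw [abs_le] at h5
  have := neg_abs_le (Real.log w)
  have := le_abs_self (Real.log S)
  have := le_abs_self L
  have := abs_nonneg (Real.log w)
  have := abs_nonneg (Real.log S)
  constructor <;> linarith

/-- The exact decrease is a `μ`-weighted sum of `exp g - 1 - g` over the log-gaps `g`. These are
uniformly bounded, so each term dominates a multiple of `g ^ 2`; Cauchy–Schwarz passes from the
squares to the squared sum. -/
theorem exists_sq_stepSize_le [Nonempty α] (hK : ∀ i, 0 < K i) (hμ : ∀ j a, 0 < μ j a)
    {w : ℝ} (hw : 0 < w) (S : ℝ) :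
    ∃ c : ℝ, 0 < c ∧ ∀ x : Γ → α → ℝ, Controlled K w S x → ∀ j,
      stepSize K μ j x ^ 2 ≤ c * (energy K μ x - energy K μ (logStep K μ j x)) := by
  obtain ⟨D, hD0, hD⟩ := exists_logGap_bound (μ := μ) hK hw S
  rcases isEmpty_or_nonempty Γ with hΓ | hΓ
  · exact ⟨1, one_pos, fun x _ j => (hΓ.false j).elim⟩
  obtain ⟨p, hp⟩ := Finite.exists_min fun p : Γ × α => μ p.1 p.2
  set m := μ p.1 p.2 with hm
  have hm0 : 0 < m := hμ _ _
  have hn : (0 : ℝ) < Fintype.card α := by exact_mod_cast Fintype.card_pos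
  set c := m * (Real.exp (-D) / 4) with hc
  have hc0 : 0 < c := by positivity
  refine ⟨Fintype.card α / c, by positivity, fun x hx j => ?_⟩
  have h1 : c * ∑ a, |logGap K μ j x a| ^ 2 ≤ energy K μ x - energy K μ (logStep K μ j x) := by
    rw [energy_sub_energy_logStep hK hμ, Finset.mul_sum]
    refine Finset.sum_le_sum fun a _ => ?_
    rw [sq_abs, hc, mul_assoc]
    exact mul_le_mul (hp (j, a)) (exp_sub_one_sub_self_ge (hD x hx j a)) (by positivity)
      (hμ _ _).le
  have h2 : stepSize K μ j x ^ 2 ≤ Fintype.card α * ∑ a, |logGap K μ j x a| ^ 2 := by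
    simpa [stepSize] using sq_sum_le_card_mul_sum_sq (s := Finset.univ)
      (f := fun a => |logGap K μ j x a|)
  calc stepSize K μ j x ^ 2 ≤ Fintype.card α / c * (c * ∑ a, |logGap K μ j x a| ^ 2) := by
        rw [← mul_assoc, div_mul_cancel₀ _ hc0.ne']; exact h2
    _ ≤ _ := mul_le_mul_of_nonneg_left h1 (by positivity)

/-- A step multiplies each weight by `exp (-g)` with a bounded log-gap `g`, so every marginal moves
by at most a multiple of the step size; the mismatch in the block itself is `μ (exp g - 1)`. -/
theorem exists_marginal_change_le [Nonempty α] (hK : ∀ i, 0 < K i) (hμ : ∀ j a, 0 < μ j a)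
    {w S : ℝ} (hw : 0 < w) (hmass : ∀ j, ∑ a, μ j a = S) :
    ∃ c : ℝ, 0 ≤ c ∧ ∀ x : Γ → α → ℝ, Controlled K w S x → ∀ j,
      (∀ a, |marginal K x j a - μ j a| ≤ c * stepSize K μ j x) ∧
      ∀ l a, |marginal K x l a - marginal K (logStep K μ j x) l a| ≤ c * stepSize K μ j x := by
  obtain ⟨D, hD0, hD⟩ := exists_logGap_bound (μ := μ) hK hw S
  refine ⟨|S| * Real.exp D, by positivity, fun x hx j => ⟨fun a => ?_, fun l b => ?_⟩⟩
  · have h1 : marginal K x j a - μ j a = μ j a * (Real.exp (logGap K μ j x a) - 1) := by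
      rw [mul_sub, exp_logGap hK hμ, mul_one]
    have h2 : μ j a ≤ |S| := by
      refine le_trans ?_ (le_abs_self S)
      rw [← hmass j]
      exact Finset.single_le_sum (fun a _ => (hμ j a).le) (Finset.mem_univ a)
    rw [h1, abs_mul, abs_of_pos (hμ j a), mul_assoc]
    refine mul_le_mul h2 ((abs_exp_sub_one_le_of_abs_le (hD x hx j a)).trans ?_) (abs_nonneg _)
      (abs_nonneg _)
    gcongr
    exact abs_logGap_le_stepSize j x a
  · have h1 : ∀ i, |(if i (l : V) = b then weight K x i else 0) -
        (if i (l : V) = b then weight K (logStep K μ j x) i else 0)| ≤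
          weight K x i * (Real.exp D * stepSize K μ j x) := by
      intro i
      have h0 := (weight_pos hK x i).le
      split_ifs
      · have : weight K x i - weight K (logStep K μ j x) i =
            -(weight K x i * (Real.exp (-logGap K μ j x (i j)) - 1)) := by
          rw [weight_logStep]; ring
        rw [this, abs_neg, abs_mul, abs_of_nonneg h0]
        gcongr
        refine (abs_exp_sub_one_le_of_abs_le (D := D) ?_).trans ?_
        · rw [abs_neg]; exact hD x hx j _
        · rw [abs_neg]; gcongr; exact abs_logGap_le_stepSize j x _
      · rw [sub_zero, abs_zero]
        exact mul_nonneg h0 (mul_nonneg (Real.exp_pos _).le (stepSize_nonneg j x))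
    rw [marginal, marginal, ← Finset.sum_sub_distrib]
    refine (Finset.abs_sum_le_sum_abs _ _).trans ((Finset.sum_le_sum fun i _ => h1 i).trans ?_)
    rw [← Finset.sum_mul, hx.2, mul_assoc]
    have := mul_nonneg (Real.exp_pos D).le (stepSize_nonneg (K := K) (μ := μ) j x)
    gcongr
    exact le_abs_self S

/-- A Polyak–Łojasiewicz inequality: the energy differences are controlled by the violation of
the marginal constraints, which is the gradient of the energy. -/
theorem exists_energy_sub_le [Nonempty α] (hK : ∀ i, 0 < K i)
    {w S : ℝ} (hw : 0 < w) (hmass : ∀ j, ∑ a, μ j a = S) :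
    ∃ c : ℝ, 0 ≤ c ∧ ∀ x y : Γ → α → ℝ, Controlled K w S x → Controlled K w S y →
      energy K μ x - energy K μ y ≤ c * violation K μ x ^ 2 := by
  set D := Real.log S - Real.log w with hD
  set c := w * (Real.exp (-D) / 4) with hc
  have hc0 : 0 < c := by positivity
  refine ⟨1 / c, by positivity, fun x y hx hy => ?_⟩
  set h := y - x with hh
  have hy' : y = x + h := by simp [hh]
  set t : (V → α) → ℝ := fun i => ∑ j : Γ, h j (i j) with ht
  -- `t i` is the change of the log-weight, and both weights lie in `[w, S]`.
  have htD : ∀ i, |t i| ≤ D := by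
    intro i
    have h1 : Real.log (weight K y i) = Real.log (weight K x i) + t i := by
      rw [hy', weight_add, Real.log_mul (weight_pos hK x i).ne' (Real.exp_pos _).ne', Real.log_exp]
    have h2 := Real.log_le_log hw (hx.1 i)
    have h3 := Real.log_le_log hw (hy.1 i)
    have h4 := Real.log_le_log (weight_pos hK x i) (hx.weight_le hK i)
    have h5 := Real.log_le_log (weight_pos hK y i) (hy.weight_le hK i)
    rw [abs_le]
    constructor <;> linarith
  obtain ⟨i₀, hi₀⟩ := Finite.exists_max fun i => |t i|
  set M := |t i₀| with hM
  have hM0 : 0 ≤ M := abs_nonneg _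
  have hquad : c * M ^ 2 ≤ ∑ i, weight K x i * (Real.exp (t i) - 1 - t i) := by
    have hterm : ∀ i, c * t i ^ 2 ≤ weight K x i * (Real.exp (t i) - 1 - t i) := by
      intro i
      rw [hc, mul_assoc]
      exact mul_le_mul (hx.1 i) (exp_sub_one_sub_self_ge (htD i)) (by positivity)
        (weight_pos hK x i).le
    have hnn : ∀ i, 0 ≤ weight K x i * (Real.exp (t i) - 1 - t i) := fun i =>
      (by positivity : 0 ≤ c * t i ^ 2).trans (hterm i)
    rw [hM, sq_abs]
    exact (hterm i₀).trans (Finset.single_le_sum (fun i _ => hnn i) (Finset.mem_univ i₀))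
  obtain ⟨a₀⟩ := ‹Nonempty α›
  -- `h` itself cannot be bounded, since constant shifts of the blocks with sum zero do not change
  -- the weights. Its oscillation in one block is a difference of two values of `t`, at
  -- configurations differing in one coordinate.
  have hdiff : ∀ j a, |h j a - h j a₀| ≤ 2 * M := by
    intro j a
    have h1 : h j a - h j a₀ = t (Function.update (fun _ => a₀) j a) - t fun _ => a₀ := by
      have := sum_update h j (fun _ => a₀) a
      have h2 := Finset.add_sum_erase Finset.univ (fun l : Γ => h l a₀) (Finset.mem_univ j)
      simp only [ht]
      linarith
    rw [h1]
    refine (abs_sub _ _).trans ?_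
    linarith [hi₀ (Function.update (fun _ => a₀) (j : V) a), hi₀ fun _ => a₀]
  -- The gradient sums to zero over each block because the masses agree, so `h j` may be replaced by
  -- `h j - h j a₀`.
  have hlin : -(2 * M * violation K μ x) ≤ ∑ j, ∑ a, (marginal K x j a - μ j a) * h j a := by
    have h1 : ∀ j, ∑ a, (marginal K x j a - μ j a) * h j a =
        ∑ a, (marginal K x j a - μ j a) * (h j a - h j a₀) := by
      intro j
      have : ∑ a, (marginal K x j a - μ j a) = 0 := by
        rw [Finset.sum_sub_distrib, sum_marginal, hx.2, hmass, sub_self]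
      simp only [mul_sub _ (h j _), Finset.sum_sub_distrib, ← Finset.sum_mul, this]
      ring
    simp only [h1]
    refine neg_le_of_abs_le ((Finset.abs_sum_le_sum_abs _ _).trans ?_)
    rw [violation, Finset.mul_sum]
    refine Finset.sum_le_sum fun j _ => (Finset.abs_sum_le_sum_abs _ _).trans ?_
    rw [Finset.mul_sum]
    refine Finset.sum_le_sum fun a _ => ?_
    rw [abs_mul, mul_comm]
    gcongr
    exact hdiff j a
  have hexp := energy_add_sub K μ x h
  rw [← hy'] at hexp
  have hfin : energy K μ x - energy K μ y ≤ 2 * M * violation K μ x - c * M ^ 2 := by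
    linarith
  refine hfin.trans ?_
  rw [one_div, inv_mul_eq_div, le_div_iff₀ hc0]
  -- The worst `M` is the violation divided by `c`; this gives the constant `1 / c`.
  nlinarith [sq_nonneg (violation K μ x - c * M)]

/-- Along a sequence of steps which visits every block in each window of length `N`, the violation
is controlled by the energy decrease. -/
theorem exists_sq_violation_le [Nonempty α] (hK : ∀ i, 0 < K i) (hμ : ∀ j a, 0 < μ j a)
    {w S : ℝ} (hw : 0 < w) (hmass : ∀ j, ∑ a, μ j a = S) (N : ℕ) :
    ∃ c : ℝ, 0 ≤ c ∧ ∀ (x : ℕ → Γ → α → ℝ) (s : ℕ → Γ), (∀ k, Controlled K w S (x k)) →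
      (∀ k, x (k + 1) = logStep K μ (s k) (x k)) → (∀ k j, ∃ t < N, s (k + t) = j) →
      ∀ k, violation K μ (x k) ^ 2 ≤ c * (energy K μ (x k) - energy K μ (x (k + N))) := by
  obtain ⟨c₁, hc₁, hstep⟩ := exists_sq_stepSize_le (Γ := Γ) hK hμ hw S
  obtain ⟨c₂, hc₂, hchange⟩ := exists_marginal_change_le (Γ := Γ) hK hμ hw hmass
  refine ⟨(Fintype.card Γ * Fintype.card α * c₂) ^ 2 * (N * c₁), by positivity,
    fun x s hx hxs hs k => ?_⟩
  set δ : ℕ → ℝ := fun r => stepSize K μ (s (k + r)) (x (k + r)) with hδ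
  have hδ0 : ∀ r, 0 ≤ δ r := fun r => stepSize_nonneg _ _
  -- Compare with the time `k + t` at which the block `j` is next treated: the marginal drifts by
  -- the intermediate steps, and its mismatch at that time is bounded by the step `δ t`.
  have hpoint : ∀ j a, |marginal K (x k) j a - μ j a| ≤ c₂ * ∑ r ∈ Finset.range N, δ r := by
    intro j a
    have htele : ∀ t, |marginal K (x k) j a - marginal K (x (k + t)) j a| ≤
        c₂ * ∑ r ∈ Finset.range t, δ r := by
      intro t
      induction t with
      | zero => simp
      | succ t ih =>
        have h1 := (hchange (x (k + t)) (hx _) (s (k + t))).2 j a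
        rw [← hxs] at h1
        rw [Finset.sum_range_succ, mul_add]
        calc _ ≤ |marginal K (x k) j a - marginal K (x (k + t)) j a| +
              |marginal K (x (k + t)) j a - marginal K (x (k + t + 1)) j a| := abs_sub_le _ _ _
          _ ≤ _ := add_le_add ih h1
    obtain ⟨t, htN, rfl⟩ := hs k j
    have h1 := (hchange (x (k + t)) (hx _) (s (k + t))).1 a
    calc _ ≤ |marginal K (x k) (s (k + t)) a - marginal K (x (k + t)) (s (k + t)) a| +
          |marginal K (x (k + t)) (s (k + t)) a - μ (s (k + t)) a| := abs_sub_le _ _ _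
      _ ≤ c₂ * ∑ r ∈ Finset.range t, δ r + c₂ * δ t := add_le_add (htele t) h1
      _ = c₂ * ∑ r ∈ Finset.range (t + 1), δ r := by rw [Finset.sum_range_succ, mul_add]
      _ ≤ _ := by
        refine mul_le_mul_of_nonneg_left ?_ hc₂
        refine Finset.sum_le_sum_of_subset_of_nonneg ?_ fun r _ _ => hδ0 r
        exact Finset.range_subset_range.2 htN
  have hviol : violation K μ (x k) ≤
      Fintype.card Γ * Fintype.card α * c₂ * ∑ r ∈ Finset.range N, δ r := by
    refine (Finset.sum_le_sum fun j _ => Finset.sum_le_sum fun a _ => hpoint j a).trans ?_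
    simp only [Finset.sum_const, Finset.card_univ, nsmul_eq_mul]
    exact le_of_eq (by ring)
  have hsq : (∑ r ∈ Finset.range N, δ r) ^ 2 ≤ N * ∑ r ∈ Finset.range N, δ r ^ 2 := by
    simpa using sq_sum_le_card_mul_sum_sq (s := Finset.range N) (f := δ)
  have hen : ∑ r ∈ Finset.range N, δ r ^ 2 ≤
      c₁ * (energy K μ (x k) - energy K μ (x (k + N))) := by
    have h1 : ∑ r ∈ Finset.range N, (energy K μ (x (k + r)) - energy K μ (x (k + (r + 1)))) =
        energy K μ (x k) - energy K μ (x (k + N)) := by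
      simpa using Finset.sum_range_sub' (fun r => energy K μ (x (k + r))) N
    rw [← h1, Finset.mul_sum]
    refine Finset.sum_le_sum fun r _ => ?_
    have := hstep (x (k + r)) (hx _) (s (k + r))
    rwa [← hxs] at this
  calc violation K μ (x k) ^ 2
      ≤ (Fintype.card Γ * Fintype.card α * c₂ * ∑ r ∈ Finset.range N, δ r) ^ 2 :=
        pow_le_pow_left₀ (violation_nonneg _) hviol 2
    _ = (Fintype.card Γ * Fintype.card α * c₂) ^ 2 * (∑ r ∈ Finset.range N, δ r) ^ 2 := by ring
    _ ≤ (Fintype.card Γ * Fintype.card α * c₂) ^ 2 *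
        (N * (c₁ * (energy K μ (x k) - energy K μ (x (k + N))))) := by
        gcongr
        exact hsq.trans (mul_le_mul_of_nonneg_left hen (Nat.cast_nonneg N))
    _ = _ := by ring

theorem continuous_marginal (j : Γ) (a : α) : Continuous fun x : Γ → α → ℝ => marginal K x j a := by
  unfold marginal weight
  refine continuous_finsetSum _ fun i _ => ?_
  split_ifs <;> fun_prop

/-- Linear convergence of the block coordinate descent to a point with the given marginals. -/
theorem exists_linear_convergence [Nonempty α] (hK : ∀ i, 0 < K i) (hμ : ∀ j a, 0 < μ j a)
    {S : ℝ} (hmass : ∀ j, ∑ a, μ j a = S) {N : ℕ} {x : ℕ → Γ → α → ℝ} {s : ℕ → Γ}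
    (hx : ∀ k, x (k + 1) = logStep K μ (s k) (x k)) (hs : ∀ k j, ∃ t < N, s (k + t) = j) :
    ∃ y : Γ → α → ℝ, (∀ j a, marginal K y j a = μ j a) ∧ ConvergesAtLeastLinearly x y := by
  have hS : 0 < S := by
    rw [← hmass (s 0)]
    exact Finset.sum_pos (fun a _ => hμ _ a) Finset.univ_nonempty
  have hN : N ≠ 0 := by
    rintro rfl
    obtain ⟨t, ht, -⟩ := hs 0 (s 0)
    omega
  obtain ⟨w, hw, hlow⟩ := exists_weight_lower_bound hK hμ hS hmass hx
  -- The initial point need not have mass `S`, so the estimates start after the first step.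
  set z : ℕ → Γ → α → ℝ := fun k => x (k + 1) with hz
  have hzx : ∀ k, z (k + 1) = logStep K μ (s (k + 1)) (z k) := fun k => hx (k + 1)
  have hzs : ∀ k j, ∃ t < N, s (k + t + 1) = j := fun k j => by
    obtain ⟨t, ht, h⟩ := hs (k + 1) j
    exact ⟨t, ht, by rw [← h]; congr 1; omega⟩
  have hzc : ∀ k, Controlled K w S (z k) := fun k =>
    ⟨hlow k, by rw [hz]; simp only; rw [hx, sum_weight_logStep hK hμ, hmass]⟩
  have hanti : Antitone fun k => energy K μ (z k) := antitone_nat_of_succ_le fun k => by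
    rw [hzx]; exact energy_logStep_le hK hμ _ _
  obtain ⟨c₁, hc₁, hstep⟩ := exists_sq_stepSize_le (Γ := Γ) hK hμ hw S
  obtain ⟨c₂, hc₂, hviol⟩ := exists_sq_violation_le (Γ := Γ) hK hμ hw hmass N
  obtain ⟨c₃, hc₃, hPL⟩ := exists_energy_sub_le (Γ := Γ) (μ := μ) hK hw hmass
  have hviol' := hviol z (fun k => s (k + 1)) hzc hzx hzs
  obtain ⟨A, q, hA, hq0, hq1, hgeo⟩ := geometric_decrease hanti hN (C := c₃ * c₂) fun k l => by
    rw [mul_assoc]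
    exact (hPL _ _ (hzc k) (hzc l)).trans (mul_le_mul_of_nonneg_left (hviol' k) hc₃)
  -- The energy controls squares of step sizes and violations, so the iterates converge at the rate
  -- `√q`.
  set r := Real.sqrt q with hr
  have hr0 : 0 < r := Real.sqrt_pos.2 hq0
  have hr1 : r < 1 := by rw [hr, Real.sqrt_lt' one_pos]; simpa using hq1
  have hrk : ∀ k, (r ^ k) ^ 2 = q ^ k := fun k => by
    rw [← pow_mul, mul_comm, pow_mul, hr, Real.sq_sqrt hq0.le]
  have hdist : ∀ k, dist (z k) (z (k + 1)) ≤ Real.sqrt (c₁ * A) * r ^ k := by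
    intro k
    rw [dist_comm, dist_eq_norm, hzx]
    refine (norm_logStep_sub_le _ _).trans ?_
    refine le_of_sq_le_sq ?_ (by positivity)
    rw [mul_pow, hrk, Real.sq_sqrt (by positivity), mul_assoc]
    refine (hstep _ (hzc k) _).trans (mul_le_mul_of_nonneg_left ?_ hc₁.le)
    rw [← hzx]
    exact hgeo k (k + 1)
  obtain ⟨y, hy⟩ := cauchySeq_tendsto_of_complete (cauchySeq_of_le_geometric r _ hr1 hdist)
  refine ⟨y, fun j a => ?_, ?_⟩
  · have h1 : Filter.Tendsto (fun k => marginal K (z k) j a) Filter.atTop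
        (nhds (marginal K y j a)) := ((continuous_marginal j a).tendsto y).comp hy
    have h2 : Filter.Tendsto (fun k => marginal K (z k) j a - μ j a) Filter.atTop (nhds 0) := by
      refine squeeze_zero_norm (a := fun k => Real.sqrt (c₂ * A) * r ^ k) (fun k => ?_) ?_
      · have h3 : |marginal K (z k) j a - μ j a| ≤ violation K μ (z k) :=
          (Finset.single_le_sum (f := fun a => |marginal K (z k) j a - μ j a|)
            (fun _ _ => abs_nonneg _) (Finset.mem_univ a)).trans
          (Finset.single_le_sum (f := fun j => ∑ a, |marginal K (z k) j a - μ j a|)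
            (fun _ _ => Finset.sum_nonneg fun _ _ => abs_nonneg _) (Finset.mem_univ j))
        refine h3.trans (le_of_sq_le_sq ?_ (by positivity))
        rw [mul_pow, hrk, Real.sq_sqrt (by positivity), mul_assoc]
        exact (hviol' k).trans (mul_le_mul_of_nonneg_left (hgeo _ _) hc₂)
      · simpa using (tendsto_pow_atTop_nhds_zero_of_lt_one hr0.le hr1).const_mul
          (Real.sqrt (c₂ * A))
    have h3 := tendsto_nhds_unique h2 (h1.sub_const (μ j a))
    linarith
  · have hdy := dist_le_of_le_geometric_of_tendsto r _ hr1 hdist hy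
    set B := Real.sqrt (c₁ * A) / (1 - r) with hB
    have hB0 : 0 ≤ B := div_nonneg (Real.sqrt_nonneg _) (by linarith)
    have hdy' : ∀ k, ‖z k - y‖ ≤ B * r ^ k := fun k => by
      rw [← dist_eq_norm]
      refine (hdy k).trans (le_of_eq ?_)
      rw [hB]; ring
    -- The first summand covers `k = 0`; the division by `r` undoes the index shift.
    refine ⟨‖x 0 - y‖ + B / r, r, hr0, hr1, fun k => ?_⟩
    cases k with
    | zero => simpa using div_nonneg hB0 hr0.le
    | succ k =>
      refine (hdy' k).trans ?_
      have h1 : B * r ^ k = B / r * r ^ (k + 1) := by rw [pow_succ]; field_simp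
      rw [h1, add_mul]
      exact le_add_of_nonneg_left (by positivity)

end Convergence

/-- Linear convergence is preserved by the entrywise exponential function. -/
theorem ConvergesAtLeastLinearly.exp {ι κ : Type*} [Fintype ι] [Fintype κ]
    {x : ℕ → ι → κ → ℝ} {y : ι → κ → ℝ} (h : ConvergesAtLeastLinearly x y) :
    ConvergesAtLeastLinearly (fun k j a => Real.exp (x k j a)) fun j a => Real.exp (y j a) := by
  obtain ⟨B, q, hq0, hq1, hB⟩ := h
  have hB0 : 0 ≤ B := by simpa using (norm_nonneg _).trans (hB 0)
  have hpt : ∀ k j a, |x k j a - y j a| ≤ B * q ^ k := fun k j a =>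
    ((norm_le_pi_norm (x k j - y j) a).trans (norm_le_pi_norm (x k - y) j)).trans (hB k)
  obtain ⟨M, hM⟩ := (Set.finite_range fun p : ι × κ => Real.exp (y p.1 p.2)).bddAbove
  refine ⟨|M| * Real.exp B * B, q, hq0, hq1, fun k => ?_⟩
  rw [pi_norm_le_iff_of_nonneg (by positivity)]
  intro j
  rw [pi_norm_le_iff_of_nonneg (by positivity)]
  intro a
  have hle : |x k j a - y j a| ≤ B :=
    (hpt k j a).trans (mul_le_of_le_one_right hB0 (pow_le_one₀ hq0.le hq1.le))
  calc _ ≤ Real.exp (y j a) * Real.exp B * |x k j a - y j a| := abs_exp_sub_exp_le _ _ _ hle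
    _ ≤ |M| * Real.exp B * (B * q ^ k) := by
      have h1 : Real.exp (y j a) ≤ |M| := (hM ⟨(j, a), rfl⟩).trans (le_abs_self M)
      gcongr
      exact hpt k j a
    _ = _ := by ring

/-! ### Summation over the configurations of a rooted tree -/

section Elimination

variable {V α : Type*} [Fintype V] [DecidableEq V] [Fintype α]

/-- The factor of the vertex `v` in a tree-structured product, after the vertices in `E` have been
summed out: the factor of an eliminated vertex with remaining parent is its message `β v`. -/
def eliminationFactor (par : V → V) (φ : V → α → α → ℝ) (β : V → α → ℝ) (E : Finset V) (v : V)
    (i : V → α) : ℝ :=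
  if v ∈ E then if par v ∈ E then 1 else β v (i (par v)) else φ v (i (par v)) (i v)

/-- Summing out a vertex all of whose children have been summed out. -/
theorem sum_eliminationFactor_insert {par : V → V} {φ : V → α → α → ℝ} {β : V → α → ℝ}
    {E : Finset V} {c : V} (hc : c ∉ E) (hpc : par c ∉ insert c E)
    (hchild : ∀ v, par v = c → v ∈ E)
    (hβ : ∀ b, β c b = ∑ a, φ c b a * ∏ v with par v = c, β v a) :
    ∑ i, ∏ v, eliminationFactor par φ β (insert c E) v i =
      Fintype.card α * ∑ i, ∏ v, eliminationFactor par φ β E v i := by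
  -- Configurations keep all coordinates, also those of eliminated vertices. The factor `card α` is
  -- traded for an extra sum over the coordinate `c`, which produces `β c`.
  rw [← nsmul_eq_mul, ← sum_sum_update _ c]
  refine Finset.sum_congr rfl fun i _ => ?_
  rw [Finset.mem_insert, not_or] at hpc
  set R : ℝ := ∏ v with v ≠ c ∧ par v ≠ c, eliminationFactor par φ β (insert c E) v i with hR
  have hsplit : ∀ f : V → ℝ, ∏ v, f v =
      f c * ((∏ v with par v = c, f v) * ∏ v with v ≠ c ∧ par v ≠ c, f v) := by
    intro f
    rw [← Finset.mul_prod_erase _ _ (Finset.mem_univ c),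
      ← Finset.prod_filter_mul_prod_filter_not (Finset.univ.erase c) (fun v => par v = c)]
    congr 2
    · refine Finset.prod_congr ?_ fun _ _ => rfl
      ext v
      simp only [Finset.mem_filter, Finset.mem_erase, Finset.mem_univ, and_true, true_and,
        and_iff_right_iff_imp]
      rintro h rfl
      exact hpc.1 h
    · refine Finset.prod_congr ?_ fun _ _ => rfl
      ext v
      simp
  have hold : ∀ b, ∏ v, eliminationFactor par φ β E v (Function.update i c b) =
      φ c (i (par c)) b * (∏ v with par v = c, β v b) * R := by
    intro b
    rw [hsplit, mul_assoc]
    congr 1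
    · simp [eliminationFactor, hc, hpc.1]
    · congr 1
      · refine Finset.prod_congr rfl fun v hv => ?_
        have hv' : par v = c := (Finset.mem_filter.1 hv).2
        simp [eliminationFactor, hchild v hv', hv', hc]
      · refine Finset.prod_congr rfl fun v hv => ?_
        obtain ⟨h1, h2⟩ := (Finset.mem_filter.1 hv).2
        simp [eliminationFactor, h1, h2]
  have hnew : ∏ v, eliminationFactor par φ β (insert c E) v i = β c (i (par c)) * R := by
    rw [hsplit]
    congr 1
    · simp [eliminationFactor, hpc]
    · rw [Finset.prod_eq_one, one_mul]
      intro v hv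
      have hv' : par v = c := (Finset.mem_filter.1 hv).2
      simp [eliminationFactor, hchild v hv', hv']
  simp only [hold, hnew, ← Finset.sum_mul, hβ]

/-- The sum over all configurations of a product over the edges and vertices of a tree with root
`r`, parent function `par` and height `ht` is computed by messages from the children to their
parents. The edge factor of the root is a function of one variable. -/
theorem sum_prod_tree {par : V → V} {ht : V → ℕ} {r : V} (hr : par r = r)
    (hpar : ∀ v, v ≠ r → ht (par v) < ht v) {φ : V → α → α → ℝ} {β : V → α → ℝ}
    (hβ : ∀ c, c ≠ r → ∀ b, β c b = ∑ a, φ c b a * ∏ v with par v = c, β v a) :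
    ∑ i : V → α, ∏ v, φ v (i (par v)) (i v) =
      ∑ a, φ r a a * ∏ v with v ≠ r ∧ par v = r, β v a := by
  rcases isEmpty_or_nonempty α with hα | hα
  · have : IsEmpty (V → α) := ⟨fun i => hα.false (i r)⟩
    simp
  have hn : (0 : ℝ) < Fintype.card α := by exact_mod_cast Fintype.card_pos
  -- The eliminated set is closed under passing to children, and each elimination costs one factor
  -- `card α`.
  have key : ∀ d : ℕ, d ≤ (Finset.univ.erase r).card → ∃ E : Finset V, E.card = d ∧ r ∉ E ∧
      (∀ v, v ≠ r → par v ∈ E → v ∈ E) ∧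
      ∑ i, ∏ v, eliminationFactor par φ β E v i =
        (Fintype.card α : ℝ) ^ d * ∑ i : V → α, ∏ v, φ v (i (par v)) (i v) := by
    intro d
    induction d with
    | zero => exact fun _ => ⟨∅, by simp [eliminationFactor]⟩
    | succ d ih =>
      intro hd
      obtain ⟨E, hE, hrE, hup, hsum⟩ := ih (by omega)
      -- A remaining vertex of maximal height has only eliminated children.
      obtain ⟨c, hcm, hmax⟩ := Finset.exists_max_image ((Finset.univ.erase r) \ E) ht (by
        rw [← Finset.card_pos]
        have := Finset.le_card_sdiff E (Finset.univ.erase r)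
        omega)
      simp only [Finset.mem_sdiff, Finset.mem_erase, Finset.mem_univ, and_true] at hcm hmax
      obtain ⟨hcr, hcE⟩ := hcm
      have hchild : ∀ v, par v = c → v ∈ E := by
        intro v hv
        have hvr : v ≠ r := by rintro rfl; exact hcr (hv ▸ hr)
        by_contra hvE
        have h1 := hmax v ⟨hvr, hvE⟩
        have h2 := hpar v hvr
        rw [hv] at h2
        omega
      have hpc : par c ∉ insert c E := by
        rw [Finset.mem_insert, not_or]
        refine ⟨fun h => ?_, fun h => hcE (hup c hcr h)⟩
        have := hpar c hcr
        rw [h] at this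
        omega
      refine ⟨insert c E, by rw [Finset.card_insert_of_notMem hcE, hE], ?_, ?_, ?_⟩
      · rw [Finset.mem_insert, not_or]
        exact ⟨hcr.symm, hrE⟩
      · intro v hv hvE
        rcases Finset.mem_insert.1 hvE with h | h
        · exact Finset.mem_insert_of_mem (hchild v h)
        · exact Finset.mem_insert_of_mem (hup v hv h)
      · rw [sum_eliminationFactor_insert hcE hpc hchild (hβ c hcr), hsum, pow_succ]
        ring
  obtain ⟨E, hE, hrE, -, hsum⟩ := key _ le_rfl
  have hEr : E = Finset.univ.erase r := by
    refine Finset.eq_of_subset_of_card_le (fun v hv => ?_) hE.ge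
    exact Finset.mem_erase.2 ⟨fun h => hrE (h ▸ hv), Finset.mem_univ v⟩
  have hfac : ∀ i : V → α, ∏ v, eliminationFactor par φ β E v i =
      φ r (i r) (i r) * ∏ v with v ≠ r ∧ par v = r, β v (i r) := by
    intro i
    rw [← Finset.mul_prod_erase _ _ (Finset.mem_univ r)]
    congr 1
    · simp [eliminationFactor, hrE, hr]
    · have : (Finset.univ.filter fun v => v ≠ r ∧ par v = r) =
          (Finset.univ.erase r).filter fun v => par v = r := by ext v; simp
      rw [this, Finset.prod_filter]
      refine Finset.prod_congr rfl fun v hv => ?_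
      have hvr : v ≠ r := Finset.ne_of_mem_erase hv
      by_cases h : par v = r <;> simp [eliminationFactor, hEr, hvr, h]
  -- The free coordinates away from the root contribute exactly the power of `card α` accumulated
  -- above, which then cancels.
  have hroot : ∀ g : α → ℝ, ∑ i : V → α, g (i r) =
      (Fintype.card α : ℝ) ^ (Finset.univ.erase r).card * ∑ a, g a := by
    intro g
    have h1 := Finset.prod_univ_sum (fun _ : V => (Finset.univ : Finset α))
      fun v a => if v = r then g a else 1
    rw [← Finset.mul_prod_erase _ _ (Finset.mem_univ r), Fintype.piFinset_univ] at h1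
    have h2 : ∏ v ∈ Finset.univ.erase r, ∑ a : α, (if v = r then g a else 1) =
        (Fintype.card α : ℝ) ^ (Finset.univ.erase r).card := by
      rw [← Finset.prod_const]
      refine Finset.prod_congr rfl fun v hv => ?_
      simp [Finset.ne_of_mem_erase hv]
    have h3 : ∀ i : V → α, ∏ v, (if v = r then g (i v) else 1) = g (i r) := fun i => by
      simp
    simp only [if_true, h2, h3] at h1
    rw [← h1, mul_comm]
  simp only [hfac] at hsum
  rw [hroot fun a => φ r a a * ∏ v with v ≠ r ∧ par v = r, β v a] at hsum
  exact (mul_left_cancel₀ (pow_pos hn _).ne' hsum).symm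

end Elimination

/-! ### Trees with a distinguished root -/

section Rooted

variable {V : Type*} {T : SimpleGraph V}

/-- The vertex `a` is the neighbour of `b` which is closer to `r`. -/
def IsParent (T : SimpleGraph V) (r a b : V) : Prop :=
  T.Adj a b ∧ T.dist r b = T.dist r a + 1

theorem exists_isParent (hT : T.IsTree) {r v : V} (hv : v ≠ r) : ∃ a, IsParent T r a v := by
  obtain ⟨p, hp⟩ := hT.connected.exists_walk_length_eq_dist v r
  cases p with
  | nil => exact (hv rfl).elim
  | @cons _ a _ h p =>
    refine ⟨a, h.symm, ?_⟩
    have h1 := SimpleGraph.dist_le p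
    rw [SimpleGraph.Walk.length_cons] at hp
    rw [SimpleGraph.dist_comm (u := r), SimpleGraph.dist_comm (u := r)]
    rcases hT.dist_eq_dist_add_one_of_adj r h with h2 | h2 <;>
      simp only [SimpleGraph.dist_comm (u := r)] at h2 <;> omega

/-- A geodesic from `r` to a parent, prolonged by the edge to `b`, is again a geodesic. In a tree
there is only one path from `r` to `b`, and the parent is its penultimate vertex. -/
theorem IsParent.unique (hT : T.IsTree) {r a a' b : V} (h : IsParent T r a b)
    (h' : IsParent T r a' b) : a = a' := by
  have key : ∀ c, IsParent T r c b → ∃ p : T.Walk r b, p.IsPath ∧ p.penultimate = c := by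
    intro c hc
    obtain ⟨p, hp⟩ := hT.connected.exists_walk_length_eq_dist r c
    refine ⟨p.concat hc.1, SimpleGraph.Walk.isPath_of_length_eq_dist _ ?_, by simp⟩
    rw [SimpleGraph.Walk.length_concat, hp, hc.2]
  obtain ⟨p, hp, rfl⟩ := key a h
  obtain ⟨p', hp', rfl⟩ := key a' h'
  rw [(hT.existsUnique_path r b).unique hp hp']

theorem isParent_or_isParent (hT : T.IsTree) (r : V) {a b : V} (h : T.Adj a b) :
    IsParent T r a b ∨ IsParent T r b a := by
  rcases hT.dist_eq_dist_add_one_of_adj r h with h1 | h1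
  · exact Or.inr ⟨h.symm, h1⟩
  · exact Or.inl ⟨h, h1⟩

theorem IsParent.not_symm {r a b : V} (h : IsParent T r a b) : ¬IsParent T r b a := fun h' => by
  have := h.2
  have := h'.2
  omega

theorem IsParent.ne_root {r a b : V} (h : IsParent T r a b) : b ≠ r := by
  rintro rfl
  have := h.2
  simp at this

/-- Moving the root to an adjacent vertex reverses only the edge between the two roots. -/
theorem IsParent.of_adj_root (hT : T.IsTree) {v w a b : V} (hvw : T.Adj v w)
    (h : IsParent T w a b) : (a = w ∧ b = v) ∨ IsParent T v a b := by
  rcases isParent_or_isParent hT v h.1 with h1 | h1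
  · exact Or.inr h1
  left
  rcases eq_or_ne b v with rfl | hb
  · refine ⟨h.unique hT ⟨hvw.symm, ?_⟩, rfl⟩
    simpa using hvw.symm
  -- Here `b` would be the parent of `a` seen from `v`. Distances to `v` and `w` differ by at most
  -- one, which forces the `v`-parent `c` of `b` to be its `w`-parent as well, so `c = a`, a
  -- contradiction.
  · exfalso
    obtain ⟨c, hc⟩ := exists_isParent hT hb
    have hle : ∀ x, T.dist w x ≤ T.dist v x + 1 ∧ T.dist v x ≤ T.dist w x + 1 := fun x => by
      have h1 := hT.connected.dist_triangle (u := w) (v := v) (w := x)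
      have h2 := hT.connected.dist_triangle (u := v) (v := w) (w := x)
      rw [SimpleGraph.dist_eq_one_iff_adj.2 hvw] at h2
      rw [SimpleGraph.dist_eq_one_iff_adj.2 hvw.symm] at h1
      omega
    have hcw : IsParent T w c b := by
      rcases isParent_or_isParent hT w hc.1 with h2 | h2
      · exact h2
      · have := (hle c).1
        have := (hle a).2
        have := h.2; have := h1.2; have := hc.2; have := h2.2
        omega
    have hca := hcw.unique hT h
    subst hca
    exact hc.not_symm h1

open Classical in
/-- The parent of a vertex in the tree with root `r`; the root is its own parent. -/
noncomputable def parent (hT : T.IsTree) (r v : V) : V :=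
  if h : v = r then r else (exists_isParent hT h).choose

theorem parent_root (hT : T.IsTree) (r : V) : parent hT r r = r := by simp [parent]

theorem isParent_parent (hT : T.IsTree) {r v : V} (hv : v ≠ r) :
    IsParent T r (parent hT r v) v := by
  rw [parent, dif_neg hv]
  exact (exists_isParent hT hv).choose_spec

theorem isParent_iff (hT : T.IsTree) {r a b : V} :
    IsParent T r a b ↔ b ≠ r ∧ parent hT r b = a :=
  ⟨fun h => ⟨h.ne_root, (isParent_parent hT h.ne_root).unique hT h⟩,
    fun h => h.2 ▸ isParent_parent hT h.1⟩

/-- A sum over the edges of a tree as a sum over the vertices different from the root. -/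
theorem sum_edges_eq_sum_parent [Fintype V] [LinearOrder V] [DecidableRel T.Adj] (hT : T.IsTree)
    (r : V) {c : V → V → ℝ} (hc : ∀ a b, T.Adj a b → c b a = c a b) :
    (∑ a, ∑ b, if a < b ∧ T.Adj a b then c a b else 0) =
      ∑ v ∈ Finset.univ.erase r, c (parent hT r v) v := by
  classical
  -- Edges are split according to whether the parent is the smaller or the larger endpoint; the
  -- symmetry of `c` then merges both parts into one sum over parent-child pairs.
  have h1 : (∑ a, ∑ b, if a < b ∧ T.Adj a b then c a b else 0) =
      (∑ a, ∑ b, if a < b ∧ IsParent T r a b then c a b else 0) +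
        ∑ a, ∑ b, if a < b ∧ IsParent T r b a then c a b else 0 := by
    simp only [← Finset.sum_add_distrib]
    refine Finset.sum_congr rfl fun a _ => Finset.sum_congr rfl fun b _ => ?_
    by_cases hab : a < b
    · by_cases hadj : T.Adj a b
      · rcases isParent_or_isParent hT r hadj with h | h
        · simp [hab, hadj, h, h.not_symm]
        · simp [hab, hadj, h, h.not_symm]
      · have h2 : ¬IsParent T r a b := fun h => hadj h.1
        have h3 : ¬IsParent T r b a := fun h => hadj h.1.symm
        simp [hadj, h2, h3]
    · simp [hab]
  rw [h1, Finset.sum_comm (f := fun a b => if a < b ∧ IsParent T r b a then c a b else 0)]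
  have h4 : (∑ a, ∑ b, if a < b ∧ IsParent T r a b then c a b else 0) +
      (∑ b, ∑ a, if a < b ∧ IsParent T r b a then c a b else 0) =
        ∑ b, ∑ a, if IsParent T r a b then c a b else 0 := by
    rw [Finset.sum_comm (f := fun b a => if IsParent T r a b then c a b else 0)]
    simp only [← Finset.sum_add_distrib]
    refine Finset.sum_congr rfl fun a _ => Finset.sum_congr rfl fun b _ => ?_
    by_cases h : IsParent T r a b
    · rcases lt_or_gt_of_ne h.1.ne with hlt | hlt
      · simp [h, hlt, hlt.not_gt]
      · simp [h, hlt, hlt.not_gt, hc a b h.1]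
    · simp [h]
  rw [h4, ← Finset.sum_erase_add _ _ (Finset.mem_univ r)]
  have h5 : (∑ a, if IsParent T r a r then c a r else 0) = 0 :=
    Finset.sum_eq_zero fun a _ => if_neg fun h => h.ne_root rfl
  rw [h5, add_zero]
  refine Finset.sum_congr rfl fun b hb => ?_
  simp [isParent_iff hT, Finset.ne_of_mem_erase hb]

end Rooted

variable {J n m : ℕ} {T : SimpleGraph (Fin J)} [DecidableRel T.Adj]
  {C : Fin J → Fin J → Matrix (Fin n) (Fin n) ℝ} {ε : ℝ}

/-! ### The messages compute the marginals -/

/-- Each edge joins a unique non-root vertex to its parent, and the symmetry of the costs allows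
every edge to be oriented this way. -/
theorem gibbsTensor_eq_prod (hT : T.IsTree)
    (hC : ∀ j k, T.Adj j k → C k j = (C j k).transpose) (r : Fin J) (i : Fin J → Fin n) :
    gibbsTensor T C ε i =
      ∏ v ∈ Finset.univ.erase r, gibbsMatrix C ε (parent hT r v) v (i (parent hT r v)) (i v) := by
  have h := sum_edges_eq_sum_parent hT r (c := fun a b => C a b (i a) (i b)) fun a b hab => by
    simp [hC a b hab]
  rw [gibbsTensor, costTensor, h]
  simp only [gibbsMatrix, Matrix.of_apply]
  rw [← Real.exp_sum, ← Finset.sum_neg_distrib, Finset.sum_div]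

/-- The product of the incoming messages at `r` gives the `r`-th marginal of `𝐊 ⊙ 𝐔`. -/
theorem sum_gibbsTensor_mul_outer (hT : T.IsTree)
    (hC : ∀ j k, T.Adj j k → C k j = (C j k).transpose) (u : leaves T → Fin n → ℝ)
    (r : Fin J) (a : Fin n) :
    (∑ i, if i r = a then gibbsTensor T C ε i * outer (extendByOne (leaves T) u) i else 0) =
      extendByOne (leaves T) u r a * ∏ l ∈ T.neighborFinset r, initMessages T C ε u r l a := by
  set ψ := extendByOne (leaves T) u with hψ
  -- The root factor carries the constraint `i r = a`; any other vertex carries its scaling and the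
  -- edge to its parent.
  set φ : Fin J → Fin n → Fin n → ℝ := fun v b c =>
    if v = r then (if c = a then ψ r c else 0)
    else gibbsMatrix C ε (parent hT r v) v b c * ψ v c with hφ
  set β : Fin J → Fin n → ℝ := fun v => initMessages T C ε u (parent hT r v) v with hβ
  have h := sum_prod_tree (par := parent hT r) (ht := T.dist r) (r := r) (parent_root hT r)
    (fun v hv => by rw [(isParent_parent hT hv).2]; exact Nat.lt_succ_self _) (φ := φ) (β := β)
    (fun c hc b => by
      -- The neighbours entering the recursion for the message from `c` to its parent are the
      -- children of `c`.
      have hset : (T.neighborFinset c).erase (parent hT r c) =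
          Finset.univ.filter fun v => parent hT r v = c := by
        ext v
        simp only [Finset.mem_erase, SimpleGraph.mem_neighborFinset, Finset.mem_filter,
          Finset.mem_univ, true_and]
        constructor
        · rintro ⟨h1, h2⟩
          rcases isParent_or_isParent hT r h2 with h3 | h3
          · exact ((isParent_iff hT).1 h3).2
          · exact (h1 ((isParent_iff hT).1 h3).2.symm).elim
        · intro h1
          have hv : v ≠ r := by
            rintro rfl
            exact hc (by rw [← h1, parent_root])
          have h2 : IsParent T r c v := (isParent_iff hT).2 ⟨hv, h1⟩
          refine ⟨?_, h2.1⟩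
          rintro h3
          exact h2.not_symm ((isParent_iff hT).2 ⟨hc, h3.symm⟩)
      have hp := isParent_parent hT hc
      simp only [hβ]
      rw [initMessages_eq T hT C ε u hp.1]
      simp only [message, Matrix.mulVec, dotProduct, hset, Pi.mul_apply, Finset.prod_apply, hφ,
        if_neg hc, mul_assoc]
      refine Finset.sum_congr rfl fun x _ => ?_
      congr 2
      refine Finset.prod_congr rfl fun v hv => ?_
      rw [(Finset.mem_filter.1 hv).2])
  have hlhs : ∀ i : Fin J → Fin n, ∏ v, φ v (i (parent hT r v)) (i v) =
      if i r = a then gibbsTensor T C ε i * outer ψ i else 0 := by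
    intro i
    rw [gibbsTensor_eq_prod hT hC r, outer, ← Finset.mul_prod_erase _ _ (Finset.mem_univ r),
      ← Finset.mul_prod_erase _ (fun j => ψ j (i j)) (Finset.mem_univ r)]
    have h1 : ∏ v ∈ Finset.univ.erase r, φ v (i (parent hT r v)) (i v) =
        (∏ v ∈ Finset.univ.erase r,
          gibbsMatrix C ε (parent hT r v) v (i (parent hT r v)) (i v)) *
        ∏ v ∈ Finset.univ.erase r, ψ v (i v) := by
      rw [← Finset.prod_mul_distrib]
      refine Finset.prod_congr rfl fun v hv => ?_
      simp only [hφ, if_neg (Finset.ne_of_mem_erase hv)]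
    rw [h1]
    simp only [hφ, if_true]
    split_ifs
    · ring
    · simp
  simp only [hlhs] at h
  rw [h, Finset.sum_eq_single a (fun b _ hb => by simp [hφ, hb]) (by simp)]
  simp only [hφ, if_true]
  congr 1
  have hset : (Finset.univ.filter fun v => v ≠ r ∧ parent hT r v = r) = T.neighborFinset r := by
    ext v
    simp only [Finset.mem_filter, Finset.mem_univ, true_and, SimpleGraph.mem_neighborFinset,
      ← isParent_iff hT]
    refine ⟨fun h => h.1, fun h => (isParent_or_isParent hT r h).resolve_right fun h' => ?_⟩
    exact h'.ne_root rfl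
  rw [← hset]
  refine Finset.prod_congr rfl fun v hv => ?_
  simp only [hβ, (Finset.mem_filter.1 hv).2.2]

/-! ### The stored messages are up to date -/

/-- The messages towards a leaf do not depend on the vector of this leaf. -/
theorem messageIter_update (hT : T.IsTree) (u : leaves T → Fin n → ℝ) (j : leaves T)
    (w : Fin n → ℝ) (d : ℕ) :
    ∀ a b, IsParent T j a b →
      messageIter T C ε (Function.update u j w) d a b = messageIter T C ε u d a b := by
  induction d with
  | zero => exact fun _ _ _ => rfl
  | succ d ih =>
    intro a b hab
    simp only [messageIter, message]
    congr 2
    · by_cases hb : b ∈ leaves T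
      · have : (⟨b, hb⟩ : leaves T) ≠ j := fun h => hab.ne_root (by rw [← h])
        simp [extendByOne, hb, this]
      · simp [extendByOne, hb]
    · refine Finset.prod_congr rfl fun l hl => ih b l ?_
      rw [Finset.mem_erase, SimpleGraph.mem_neighborFinset] at hl
      exact (isParent_or_isParent hT _ hl.2).resolve_right fun h => hl.1 (h.unique hT hab)

/-- If the messages towards `v` are correct, then recomputing the messages along a walk from `v`
to `w` makes the messages towards `w` correct. -/
theorem foldl_updateMessage (hT : T.IsTree) (u : leaves T → Fin n → ℝ) {v w : Fin J}
    (p : T.Walk v w) (α : Fin J → Fin J → Fin n → ℝ)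
    (hα : ∀ a b, IsParent T v a b → α a b = initMessages T C ε u a b) :
    ∀ a b, IsParent T w a b →
      p.darts.foldl (fun β e => updateMessage T C ε u e.snd e.fst β) α a b =
        initMessages T C ε u a b := by
  induction p generalizing α with
  | nil => exact hα
  | @cons v v' w h p ih =>
    rw [SimpleGraph.Walk.darts_cons, List.foldl_cons]
    refine ih _ fun a b hab => ?_
    -- Moving the root from `v` to `v'` adds only the message from `v` to `v'`. Its recomputation
    -- reads messages into `v`, which are correct.
    by_cases hc : a = v' ∧ b = v
    · obtain ⟨rfl, rfl⟩ := hc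
      rw [initMessages_eq T hT C ε u h.symm]
      simp only [updateMessage, and_self, if_true, message]
      congr 2
      refine Finset.prod_congr rfl fun l hl => hα _ _ ?_
      rw [Finset.mem_erase, SimpleGraph.mem_neighborFinset] at hl
      exact (isParent_or_isParent hT _ hl.2).resolve_right fun h => h.ne_root rfl
    · have h1 := (hab.of_adj_root hT h).resolve_left hc
      simp only [updateMessage, if_neg hc]
      exact hα a b h1

/-- In every iteration the stored messages towards the current leaf solve the recursion. -/
theorem state_messages_eq (hT : T.IsTree) (μ : leaves T → Fin n → ℝ) (σ : Fin m ≃ leaves T)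
    (u₀ : leaves T → Fin n → ℝ) (p₀ : Fin m) (k : ℕ) :
    let s := (step hT C ε μ σ)^[k] (initState T C ε u₀ p₀)
    ∀ a b, IsParent T (σ s.pos) a b → s.α a b = initMessages T C ε s.u a b := by
  induction k with
  | zero => exact fun _ _ _ => rfl
  | succ k ih =>
    intro s a b hab
    have hs : s = step hT C ε μ σ ((step hT C ε μ σ)^[k] (initState T C ε u₀ p₀)) :=
      Function.iterate_succ_apply' _ _ _
    rw [hs] at hab ⊢
    refine foldl_updateMessage hT _ _ _ (fun a b hab => ?_) a b hab
    -- Before the path update, only the vector of the current leaf has changed, and the messages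
    -- towards this leaf do not see it.
    rw [ih a b hab]
    exact (messageIter_update hT _ _ _ _ a b hab).symm

variable {J n m : ℕ} {T : SimpleGraph (Fin J)} [DecidableRel T.Adj]
  {C : Fin J → Fin J → Matrix (Fin n) (Fin n) ℝ} {ε : ℝ}

/-! ### The algorithm as block coordinate descent -/

theorem outer_extendByOne (Γ : Finset (Fin J)) (u : Γ → Fin n → ℝ) (i : Fin J → Fin n) :
    outer (extendByOne Γ u) i = ∏ j : Γ, u j (i j) := by
  have h : outer (extendByOne Γ u) i = ∏ j ∈ Γ, extendByOne Γ u j (i j) := by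
    refine (Finset.prod_subset (Finset.subset_univ Γ) fun j _ hj => ?_).symm
    simp [extendByOne, hj]
  rw [h, ← Finset.prod_coe_sort]
  exact Finset.prod_congr rfl fun j _ => by simp [extendByOne]

theorem weight_eq {Γ : Finset (Fin J)} (x : Γ → Fin n → ℝ) (i : Fin J → Fin n) :
    weight (gibbsTensor T C ε) x i =
      gibbsTensor T C ε i * outer (extendByOne Γ fun j a => Real.exp (x j a)) i := by
  rw [weight, outer_extendByOne, Real.exp_sum]

/-- Turns maximizing the dual over `lam` into minimizing the energy over `lam / ε`. -/
theorem dualObjective_eq (hε : 0 < ε) (Γ : Finset (Fin J)) (μ lam : Γ → Fin n → ℝ) :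
    dualObjective T C ε Γ μ lam =
      -ε * energy (gibbsTensor T C ε) μ fun j a => lam j a / ε := by
  have h : ∑ j : Γ, lam j ⬝ᵥ μ j = ε * ∑ j, ∑ a, lam j a / ε * μ j a := by
    simp only [Finset.mul_sum, dotProduct]
    refine Finset.sum_congr rfl fun j _ => Finset.sum_congr rfl fun a _ => ?_
    field_simp
  simp only [dualObjective, energy, weight_eq, h]
  change -ε * (∑ i, gibbsTensor T C ε i * outer (extendByOne Γ fun j a => Real.exp (lam j a / ε)) i)
    + _ = _
  ring

theorem messageIter_pos {u : leaves T → Fin n → ℝ} (hu : ∀ j a, 0 < u j a) (d : ℕ) :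
    ∀ j k a, 0 < messageIter T C ε u d j k a := by
  induction d with
  | zero => exact fun _ _ _ => one_pos
  | succ d ih =>
    intro j k a
    have hne : (Finset.univ : Finset (Fin n)).Nonempty := ⟨a, Finset.mem_univ a⟩
    refine Finset.sum_pos (fun b _ => mul_pos (Real.exp_pos _) (mul_pos ?_ ?_)) hne
    · by_cases hk : k ∈ leaves T
      · simpa [extendByOne, hk] using hu ⟨k, hk⟩ b
      · simp [extendByOne, hk]
    · rw [Finset.prod_apply]
      exact Finset.prod_pos fun l _ => ih k l b

theorem state_pos (hT : T.IsTree) (μ : leaves T → Fin n → ℝ) (σ : Fin m ≃ leaves T)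
    (u₀ : leaves T → Fin n → ℝ) (p₀ : Fin m) (k : ℕ) :
    ((step hT C ε μ σ)^[k] (initState T C ε u₀ p₀)).pos = (finRotate m)^[k] p₀ := by
  induction k with
  | zero => rfl
  | succ k ih => rw [Function.iterate_succ_apply', Function.iterate_succ_apply', ← ih]; rfl

/-- The update reads only stored messages into the current leaf, and these are up to date. So the
stored messages disappear, and an iteration depends on `u` and the current leaf alone. -/
theorem iterates_succ (hT : T.IsTree) (μ : leaves T → Fin n → ℝ) (σ : Fin m ≃ leaves T)
    (u₀ : leaves T → Fin n → ℝ) (p₀ : Fin m) (k : ℕ) :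
    let j := σ ((finRotate m)^[k] p₀)
    iterates hT C ε μ σ u₀ p₀ (k + 1) =
      Function.update (iterates hT C ε μ σ u₀ p₀ k) j
        (μ j / ∏ l ∈ T.neighborFinset j,
          initMessages T C ε (iterates hT C ε μ σ u₀ p₀ k) j l) := by
  intro j
  have hpos := state_pos (C := C) (ε := ε) hT μ σ u₀ p₀ k
  have hα := state_messages_eq (C := C) (ε := ε) hT μ σ u₀ p₀ k
  rw [iterates, Function.iterate_succ_apply']
  dsimp only at hα
  rw [hpos] at hα
  simp only [step]
  rw [hpos]
  change Function.update (iterates hT C ε μ σ u₀ p₀ k) j _ = _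
  congr 2
  refine Finset.prod_congr rfl fun l hl => hα _ _ ?_
  rw [SimpleGraph.mem_neighborFinset] at hl
  exact (isParent_or_isParent hT _ hl).resolve_right fun h => h.ne_root rfl

theorem iterates_pos (hT : T.IsTree) {μ : leaves T → Fin n → ℝ} (hμ : ∀ j a, 0 < μ j a)
    (σ : Fin m ≃ leaves T) {u₀ : leaves T → Fin n → ℝ} (hu₀ : ∀ j a, 0 < u₀ j a) (p₀ : Fin m)
    (k : ℕ) : ∀ j a, 0 < iterates hT C ε μ σ u₀ p₀ k j a := by
  induction k with
  | zero => exact hu₀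
  | succ k ih =>
    intro j a
    rw [iterates_succ]
    rcases eq_or_ne j (σ ((finRotate m)^[k] p₀)) with rfl | hj
    · rw [Function.update_self, Pi.div_apply, Finset.prod_apply]
      exact div_pos (hμ _ _) (Finset.prod_pos fun l _ => messageIter_pos ih _ _ _ _)
    · rw [Function.update_of_ne hj]
      exact ih j a

/-- In logarithmic variables an iteration is an exact minimization in one block. -/
theorem log_iterates_succ (hT : T.IsTree) (hC : ∀ j k, T.Adj j k → C k j = (C j k).transpose)
    {μ : leaves T → Fin n → ℝ} (hμ : ∀ j a, 0 < μ j a) (σ : Fin m ≃ leaves T)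
    {u₀ : leaves T → Fin n → ℝ} (hu₀ : ∀ j a, 0 < u₀ j a) (p₀ : Fin m) (k : ℕ) :
    (fun j a => Real.log (iterates hT C ε μ σ u₀ p₀ (k + 1) j a)) =
      logStep (gibbsTensor T C ε) μ (σ ((finRotate m)^[k] p₀))
        fun j a => Real.log (iterates hT C ε μ σ u₀ p₀ k j a) := by
  set j := σ ((finRotate m)^[k] p₀) with hj
  set u := iterates hT C ε μ σ u₀ p₀ k with hu
  have hupos : ∀ j a, 0 < u j a := iterates_pos hT hμ σ hu₀ p₀ k
  have hmarg : ∀ a, marginal (gibbsTensor T C ε) (fun j a => Real.log (u j a)) j a =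
      u j a * ∏ l ∈ T.neighborFinset j, initMessages T C ε u j l a := by
    intro a
    have h := sum_gibbsTensor_mul_outer (ε := ε) hT hC u j a
    have h2 : extendByOne (leaves T) u j a = u j a := by simp [extendByOne]
    rw [h2] at h
    rw [← h]
    simp only [marginal, weight_eq, Real.exp_log (hupos _ _)]
  ext l a
  rw [iterates_succ]
  rcases eq_or_ne l j with rfl | hl
  · have hprod : 0 < ∏ l ∈ T.neighborFinset j, initMessages T C ε u j l a :=
      Finset.prod_pos fun l _ => messageIter_pos hupos _ _ _ _
    simp only [logStep, Function.update_self, hmarg, ← hj, ← hu, Pi.div_apply, Finset.prod_apply]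
    rw [Real.log_div (hμ _ _).ne' hprod.ne', Real.log_mul (hupos _ _).ne' hprod.ne']
    ring
  · simp only [logStep, ← hj, ← hu, Function.update_of_ne hl]

/-- Provides the window length: every leaf is treated within any `m` consecutive iterations. -/
theorem exists_finRotate_iterate_eq (p q : Fin m) : ∃ t < m, (finRotate m)^[t] p = q := by
  cases m with
  | zero => exact p.elim0
  | succ m =>
    have h : ∀ t : ℕ, ((finRotate (m + 1))^[t] p).val = (p.val + t) % (m + 1) := by
      intro t
      induction t with
      | zero => simp [Nat.mod_eq_of_lt p.isLt]
      | succ t ih =>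
        rw [Function.iterate_succ_apply', finRotate_apply, Fin.val_add, ih, Fin.val_one']
        simp [add_assoc]
    -- The witness is `q - p` modulo `m + 1`, shifted by `m + 1` to avoid truncated subtraction.
    refine ⟨(q.val + (m + 1 - p.val)) % (m + 1), Nat.mod_lt _ (Nat.succ_pos m), Fin.ext ?_⟩
    have h1 : p.val + (q.val + (m + 1 - p.val)) = q.val + (m + 1) := by
      have := p.isLt
      omega
    rw [h, Nat.add_mod_mod, h1, Nat.add_mod_right, Nat.mod_eq_of_lt q.isLt]

end TreeSinkhorn

/-! ### Linear convergence of the algorithm -/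

theorem mainTheorem4 {J n m : ℕ} (T : SimpleGraph (Fin J)) [DecidableRel T.Adj] (hT : T.IsTree)
    (C : Fin J → Fin J → Matrix (Fin n) (Fin n) ℝ)
    (hC_symm : ∀ j k, T.Adj j k → C k j = (C j k).transpose)
    (hC_nonneg : ∀ j k, T.Adj j k → ∀ a b, 0 ≤ C j k a b)
    (ε : ℝ) (hε : 0 < ε)
    (μ : TreeSinkhorn.leaves T → Fin n → ℝ)
    (hμ_pos : ∀ j a, 0 < μ j a)
    (hμ_mass : ∀ j k, ∑ a, μ j a = ∑ a, μ k a)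
    (σ : Fin m ≃ TreeSinkhorn.leaves T)
    (u₀ : TreeSinkhorn.leaves T → Fin n → ℝ) (hu₀ : ∀ j a, 0 < u₀ j a)
    (p₀ : Fin m) :
    ∃ lam : TreeSinkhorn.leaves T → Fin n → ℝ,
      TreeSinkhorn.IsDualOptimal T C ε (TreeSinkhorn.leaves T) μ lam ∧
      TreeSinkhorn.ConvergesAtLeastLinearly
        (TreeSinkhorn.iterates hT C ε μ σ u₀ p₀)
        (TreeSinkhorn.scaling ε lam) := by
  open TreeSinkhorn in
  have hK : ∀ i, 0 < gibbsTensor T C ε i := fun i => Real.exp_pos _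
  rcases isEmpty_or_nonempty (Fin n) with hn | hn
  -- For `n = 0` there is only one family of vectors, so any rate works.
  · refine ⟨0, fun lam _ => ?_, 0, 1 / 2, by norm_num, by norm_num, fun k => ?_⟩
    · rw [Subsingleton.elim lam 0]
      exact le_refl (dualObjective T C ε (leaves T) μ 0)
    · rw [Subsingleton.elim (iterates hT C ε μ σ u₀ p₀ k) (scaling ε 0)]
      simp
  obtain ⟨y, hy, hconv⟩ := exists_linear_convergence hK hμ_pos
    (fun j => hμ_mass j (σ p₀)) (N := m)
    (x := fun k j a => Real.log (iterates hT C ε μ σ u₀ p₀ k j a))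
    (s := fun k => σ ((finRotate m)^[k] p₀))
    (log_iterates_succ hT hC_symm hμ_pos σ hu₀ p₀)
    (fun k j => by
      obtain ⟨t, ht, h⟩ := exists_finRotate_iterate_eq ((finRotate m)^[k] p₀) (σ.symm j)
      refine ⟨t, ht, ?_⟩
      rw [add_comm, Function.iterate_add_apply, h, Equiv.apply_symm_apply])
  have hlam : ∀ j a, ε * y j a / ε = y j a := fun j a => by field_simp
  -- The limit `y` lives in the variables `lam / ε`, so the dual solution is `ε * y`.
  refine ⟨fun j a => ε * y j a, fun lam _ => ?_, ?_⟩
  · change dualObjective _ _ _ _ _ _ ≤ dualObjective _ _ _ _ _ _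
    simp only [dualObjective_eq hε, hlam]
    exact mul_le_mul_of_nonpos_left (energy_le_of_marginal_eq hK hy _) (neg_nonpos.2 hε.le)
  · have h := hconv.exp
    simp only [Real.exp_log (iterates_pos hT hμ_pos σ hu₀ p₀ _ _ _)] at h
    have hs : scaling ε (fun j a => ε * y j a) = fun j a => Real.exp (y j a) := by
      funext j a
      simp only [scaling, hlam]
    rw [hs]
    exact h
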